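/- Let $k$ be a field and let $G$ be a finite simple graph (not necessarily connected) with vertex set $V_G=\{x_1,\dots,x_n\}$. Let $R=k[x_1,\dots,x_n]$ and let $I(G)=\langle x_ax_b : \{x_a,x_b\}\text{ is an edge of }G\rangle\subseteq R$ be the edge ideal of $G$. For a homogeneous ideal $I\subseteq R$ let $\beta_{i,j}(I)=\dim_k \operatorname{Tor}_i^R(I,k)_j$ be its graded Betti numbers, where $k=R/(x_1,\dots,x_n)$. For $m\ge 1$ let $k_m(G)$ be the number of induced subgraphs of $G$ isomorphic to the complete graph $K_m$, and let $\deg v$ be the number of edges of $G$ incident to the vertex $v$. If $G$ has no induced $4$-cycle, that is, if there is no set $S$ of four vertices such that the induced subgraph of $G$ on $S$ is isomorphic to the cycle $C_4$, then $$\beta_{i,i+2}(I(G))=\sum_{v\in V_G}\binom{\deg v}{i+1}-k_{i+2}(G)\qquad\text{for all } i\ge 0.$$ Furthermore, for $i=0$ and $i=1$ this formula holds for every finite simple graph $G$. -/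

import Mathlib

noncomputable section

namespace EdgeIdealBetti

open MvPolynomial

attribute [local instance] MvPolynomial.gradedAlgebra

/-! ### Edge ideals and induced subgraphs -/

/-- The edge ideal of a simple graph `G`: the ideal of the polynomial ring over `k`, with one
variable per vertex, generated by the products `x_u x_v` over the edges `{u, v}`. -/
def edgeIdeal (k : Type*) [Field k] {V : Type*} (G : SimpleGraph V) :
    Ideal (MvPolynomial V k) :=
  Ideal.span {p | ∃ u v : V, G.Adj u v ∧ p = X u * X v}

/-- The number of induced subgraphs of `G` that are isomorphic to `H`, that is, the number of
vertex sets `S` such that the induced subgraph of `G` on `S` is isomorphic to `H`. -/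
def inducedCount {V W : Type*} (G : SimpleGraph V) (H : SimpleGraph W) : ℕ :=
  {S : Finset V | Nonempty (G.induce (S : Set V) ≃g H)}.ncard

/-- `k_m(G)`: the number of induced subgraphs of `G` isomorphic to the complete graph `K_m`. -/
def completeCount {V : Type*} (m : ℕ) (G : SimpleGraph V) : ℕ :=
  inducedCount G (SimpleGraph.completeGraph (Fin m))

/-- `G` has no induced 4-cycle: for no set `S` of four vertices is the induced subgraph of `G` on
`S` isomorphic to the cycle `C_4`. -/
def NoInducedFourCycle {V : Type*} (G : SimpleGraph V) : Prop :=
  ∀ S : Finset V, S.card = 4 → ¬ Nonempty (G.induce (S : Set V) ≃g SimpleGraph.cycleGraph 4)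

/-! ### Graded free resolutions -/

section

variable {k : Type*} [Field k] {V : Type*}

/-- The matrix `A`, read as a map from the graded free module with basis elements of degrees `e c`
to the one with basis elements of degrees `d b`, is homogeneous of degree zero: its `(b, c)` entry
is a form of degree `e c - d b` (and is zero if this number is negative). -/
def IsGradedMatrix {r s : ℕ} (d : Fin r → ℕ) (e : Fin s → ℕ)
    (A : Matrix (Fin r) (Fin s) (MvPolynomial V k)) : Prop :=
  ∀ b c, A b c = 0 ∨ ∃ m, (A b c).IsHomogeneous m ∧ d b + m = e c

/-- A graded free resolution `⋯ ⟶ F₁ ⟶ F₀ ⟶ I ⟶ 0` of an ideal `I` of `R = k[x_v : v ∈ V]` by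
graded free modules of finite rank, `F n = ⨁_b R(-deg n b)`. It need not be minimal. -/
structure GradedFreeResolution (I : Ideal (MvPolynomial V k)) where
  /-- the rank of `F n` -/
  rank : ℕ → ℕ
  /-- the degrees of the basis elements of `F n` -/
  deg : (n : ℕ) → Fin (rank n) → ℕ
  /-- the images in `I` of the basis elements of `F 0` -/
  aug : Fin (rank 0) → MvPolynomial V k
  /-- the differential `F (n + 1) ⟶ F n`, as a matrix acting on column vectors -/
  diff : (n : ℕ) → Matrix (Fin (rank n)) (Fin (rank (n + 1))) (MvPolynomial V k)
  aug_homogeneous : ∀ b, (aug b).IsHomogeneous (deg 0 b)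
  diff_homogeneous : ∀ n, IsGradedMatrix (deg n) (deg (n + 1)) (diff n)
  /-- surjectivity onto `I` -/
  span_aug : Ideal.span (Set.range aug) = I
  /-- exactness at `F 0` -/
  exact_zero : Function.Exact (diff 0).mulVecLin
    (Fintype.linearCombination (MvPolynomial V k) aug)
  /-- exactness at `F (n + 1)` -/
  exact_succ : ∀ n, Function.Exact (diff (n + 1)).mulVecLin (diff n).mulVecLin

namespace GradedFreeResolution

variable {I : Ideal (MvPolynomial V k)} (F : GradedFreeResolution I)

/-- The degree `j` part of `F n ⊗_R k`, where `k = R / (x_v : v ∈ V)`: the `k`-vector space on the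
basis elements of `F n` of degree `j`. -/
abbrev Fiber (n j : ℕ) : Type _ := {b : Fin (F.rank n) // F.deg n b = j} → k

/-- The degree `j` part of the differential `F (n + 1) ⊗_R k ⟶ F n ⊗_R k`: its matrix is obtained
by sending all variables to zero. -/
def fiberDiff (n j : ℕ) : F.Fiber (n + 1) j →ₗ[k] F.Fiber n j :=
  Matrix.mulVecLin (Matrix.of fun b c => constantCoeff (F.diff n b.1 c.1))

/-- The cycles of `F ⊗_R k` in homological degree `i` and internal degree `j`. -/
def cycles : (i j : ℕ) → Submodule k (F.Fiber i j)
  | 0, _ => ⊤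
  | i + 1, j => LinearMap.ker (F.fiberDiff i j)

/-- The boundaries of `F ⊗_R k` in homological degree `i` and internal degree `j`. -/
def boundaries (i j : ℕ) : Submodule k (F.Fiber i j) :=
  LinearMap.range (F.fiberDiff i j)

/-- `Tor_i^R(I, k)_j`, the degree `j` part of the `i`-th homology of `F ⊗_R k`. -/
abbrev GradedTor (i j : ℕ) : Type _ :=
  F.cycles i j ⧸ (F.boundaries i j).submoduleOf (F.cycles i j)

end GradedFreeResolution

/-! ### Existence of graded free resolutions -/

/-- The coordinates of the degree `m` part of an element whose coordinate in front of a basis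
element of degree `a` is `p`. -/
def shiftComp (a m : ℕ) (p : MvPolynomial V k) : MvPolynomial V k :=
  if a ≤ m then homogeneousComponent (m - a) p else 0

/-- The degree `m` part of an element of a graded free module. -/
def vecComp {r : ℕ} (d : Fin r → ℕ) (m : ℕ) (v : Fin r → MvPolynomial V k) :
    Fin r → MvPolynomial V k :=
  fun b => shiftComp (d b) m (v b)

lemma shiftComp_sum_range (a M : ℕ) (p : MvPolynomial V k) (h : a + p.totalDegree + 1 ≤ M) :
    ∑ m ∈ Finset.range M, shiftComp a m p = p := by
  obtain ⟨N, rfl⟩ := Nat.exists_eq_add_of_le h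
  rw [add_assoc, add_assoc, Finset.sum_range_add, Finset.sum_eq_zero, zero_add,
    ← add_assoc, Finset.sum_range_add]
  · have h1 : ∀ m, shiftComp a (a + m) p = homogeneousComponent m p := by
      intro m
      simp [shiftComp]
    simp only [h1]
    rw [sum_homogeneousComponent, Finset.sum_eq_zero, add_zero]
    intro x _
    exact homogeneousComponent_eq_zero _ _ (by omega)
  · intro x hx
    have := Finset.mem_range.1 hx
    simp only [shiftComp]
    rw [if_neg (by omega)]

lemma shiftComp_mul {a e c m : ℕ} {q p : MvPolynomial V k} (hq : q.IsHomogeneous e)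
    (h : a + e = c) : shiftComp a m (q * p) = q * shiftComp c m p := by
  have hq' : q ∈ homogeneousSubmodule V k e := hq
  unfold shiftComp
  by_cases h1 : a ≤ m
  · rw [if_pos h1]
    have key : ∀ (n : ℕ) (f : MvPolynomial V k),
        (DirectSum.decompose (homogeneousSubmodule V k) f n : MvPolynomial V k) =
          homogeneousComponent n f := fun n f => decomposition.decompose'_apply f n
    by_cases h2 : c ≤ m
    · rw [if_pos h2, ← key, ← key,
        DirectSum.coe_decompose_mul_of_left_mem_of_le _ hq' (by omega)]
      rw [show m - a - e = m - c by omega]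
    · rw [if_neg h2, ← key, DirectSum.coe_decompose_mul_of_left_mem_of_not_le _ hq' (by omega),
        mul_zero]
  · rw [if_neg h1, if_neg (by omega), mul_zero]

lemma shiftComp_finset_sum {ι : Type*} (s : Finset ι) (a m : ℕ) (f : ι → MvPolynomial V k) :
    shiftComp a m (∑ i ∈ s, f i) = ∑ i ∈ s, shiftComp a m (f i) := by
  unfold shiftComp
  split_ifs
  · rw [map_sum]
  · simp

lemma mulVec_vecComp {r s : ℕ} {d : Fin r → ℕ} {e : Fin s → ℕ}
    {A : Matrix (Fin r) (Fin s) (MvPolynomial V k)} (hA : IsGradedMatrix d e A) (m : ℕ)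
    (v : Fin s → MvPolynomial V k) :
    A.mulVec (vecComp e m v) = vecComp d m (A.mulVec v) := by
  funext b
  simp only [Matrix.mulVec, dotProduct, vecComp]
  rw [shiftComp_finset_sum]
  refine Finset.sum_congr rfl fun c _ => ?_
  rcases hA b c with h | ⟨n, h1, h2⟩
  · simp [h, shiftComp]
  · rw [shiftComp_mul h1 h2]

/-- A graded submodule of a graded free module is the image of a graded matrix. -/
lemma exists_graded_generators [Finite V] {r : ℕ} (d : Fin r → ℕ)
    (N : Submodule (MvPolynomial V k) (Fin r → MvPolynomial V k))
    (hN : ∀ v ∈ N, ∀ m, vecComp d m v ∈ N) :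
    ∃ (s : ℕ) (e : Fin s → ℕ) (A : Matrix (Fin r) (Fin s) (MvPolynomial V k)),
      IsGradedMatrix d e A ∧ LinearMap.range A.mulVecLin = N := by
  set H : Set (Fin r → MvPolynomial V k) :=
    {v | v ∈ N ∧ ∃ n, ∀ b, v b = 0 ∨ ∃ m, (v b).IsHomogeneous m ∧ d b + m = n} with hH
  have hspan : Submodule.span (MvPolynomial V k) H = N := by
    apply le_antisymm
    · rw [Submodule.span_le]
      exact fun v hv => hv.1
    · intro v hv
      obtain ⟨M, hM⟩ : ∃ M, ∀ b, d b + (v b).totalDegree + 1 ≤ M :=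
        ⟨∑ b, (d b + (v b).totalDegree + 1), fun b =>
          Finset.single_le_sum (f := fun b => d b + (v b).totalDegree + 1)
            (fun _ _ => Nat.zero_le _) (Finset.mem_univ b)⟩
      have hv' : v = ∑ m ∈ Finset.range M, vecComp d m v := by
        funext b
        rw [Finset.sum_apply]
        exact (shiftComp_sum_range _ _ _ (hM b)).symm
      rw [hv']
      refine Submodule.sum_mem _ fun m _ => Submodule.subset_span ⟨hN v hv m, m, fun b => ?_⟩
      by_cases hb : d b ≤ m
      · right
        refine ⟨m - d b, ?_, by omega⟩
        simp only [vecComp, shiftComp, if_pos hb]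
        exact homogeneousComponent_isHomogeneous _ _
      · left
        simp only [vecComp, shiftComp, if_neg hb]
  have hfg : (Submodule.span (MvPolynomial V k) H).FG := IsNoetherian.noetherian _
  obtain ⟨t, htH, ht⟩ := (Submodule.fg_span_iff_fg_span_finset_subset H).1 hfg
  have hc : ∀ c : Fin t.card, ∃ n, ∀ b, (t.equivFin.symm c).1 b = 0 ∨
      ∃ m, ((t.equivFin.symm c).1 b).IsHomogeneous m ∧ d b + m = n :=
    fun c => (htH (t.equivFin.symm c).2).2
  choose e he using hc
  refine ⟨t.card, e, Matrix.of fun b c => (t.equivFin.symm c).1 b, fun b c => he c b, ?_⟩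
  rw [Matrix.range_mulVecLin, ← hspan, ht]
  congr 1
  ext v
  constructor
  · rintro ⟨c, rfl⟩
    exact (t.equivFin.symm c).2
  · intro hv
    refine ⟨t.equivFin ⟨v, hv⟩, ?_⟩
    funext b
    simp [Matrix.col]

/-- A graded matrix, as one step in the construction of a resolution. -/
structure Step (k : Type*) [Field k] (V : Type*) where
  r : ℕ
  s : ℕ
  d : Fin r → ℕ
  e : Fin s → ℕ
  A : Matrix (Fin r) (Fin s) (MvPolynomial V k)
  hA : IsGradedMatrix d e A

lemma Step.exists_next [Finite V] (S : Step k V) :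
    ∃ (s : ℕ) (e : Fin s → ℕ) (A : Matrix (Fin S.s) (Fin s) (MvPolynomial V k)),
      IsGradedMatrix S.e e A ∧ LinearMap.range A.mulVecLin = LinearMap.ker S.A.mulVecLin := by
  refine exists_graded_generators S.e _ fun v hv m => ?_
  rw [LinearMap.mem_ker, Matrix.mulVecLin_apply] at hv ⊢
  rw [mulVec_vecComp S.hA, hv]
  funext b
  simp [vecComp, shiftComp]

/-- The next step: a graded matrix whose image is the kernel of the given one. -/
def Step.next [Finite V] (S : Step k V) : Step k V where
  r := S.s
  s := S.exists_next.choose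
  d := S.e
  e := S.exists_next.choose_spec.choose
  A := S.exists_next.choose_spec.choose_spec.choose
  hA := S.exists_next.choose_spec.choose_spec.choose_spec.1

lemma Step.exact_next [Finite V] (S : Step k V) :
    Function.Exact S.next.A.mulVecLin S.A.mulVecLin :=
  LinearMap.exact_iff.2 S.exists_next.choose_spec.choose_spec.choose_spec.2.symm

/-- Iterated steps. -/
def Step.seq [Finite V] (S : Step k V) : ℕ → Step k V
  | 0 => S
  | n + 1 => (Step.seq S n).next

/-- Every homogeneous ideal of a polynomial ring in finitely many variables over a field has a
graded free resolution. -/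
theorem exists_gradedFreeResolution [Finite V] (I : Ideal (MvPolynomial V k))
    (hI : I.IsHomogeneous (homogeneousSubmodule V k)) : Nonempty (GradedFreeResolution I) := by
  let N : Submodule (MvPolynomial V k) (Fin 1 → MvPolynomial V k) :=
    Submodule.comap (LinearMap.proj (R := MvPolynomial V k)
      (φ := fun _ : Fin 1 => MvPolynomial V k) (0 : Fin 1)) I
  obtain ⟨s, e, A, hA, hr⟩ := exists_graded_generators (fun _ : Fin 1 => 0) N (by
    intro v hv m
    change shiftComp 0 m (v 0) ∈ I
    simpa [shiftComp] using homogeneousComponent_mem_of_mem hI hv m)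
  let S : Step k V := ⟨1, s, fun _ => 0, e, A, hA⟩
  have haug : ∀ v : Fin s → MvPolynomial V k,
      Fintype.linearCombination (MvPolynomial V k) (fun b => A 0 b) v = A.mulVec v 0 := by
    intro v
    simp [Fintype.linearCombination_apply, Matrix.mulVec, dotProduct, mul_comm]
  refine ⟨{
    rank := fun n => (S.seq n).s
    deg := fun n => (S.seq n).e
    aug := fun b => A 0 b
    diff := fun n => (S.seq n).next.A
    aug_homogeneous := ?_
    diff_homogeneous := fun n => (S.seq n).next.hA
    span_aug := ?_
    exact_zero := ?_
    exact_succ := fun n => (S.seq n).next.exact_next }⟩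
  · intro b
    rcases hA 0 b with h | ⟨m, h1, h2⟩
    · change (A 0 b).IsHomogeneous (e b)
      rw [h]
      exact isHomogeneous_zero _ _ _
    · change (A 0 b).IsHomogeneous (e b)
      rw [← h2, zero_add]
      exact h1
  · change Submodule.span (MvPolynomial V k) (Set.range fun b => A 0 b) = I
    rw [← Fintype.range_linearCombination]
    ext p
    constructor
    · rintro ⟨v, rfl⟩
      rw [haug]
      have : A.mulVecLin v ∈ N := hr ▸ LinearMap.mem_range_self _ v
      exact this
    · intro hp
      have : (fun _ => p : Fin 1 → MvPolynomial V k) ∈ N := hp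
      rw [← hr] at this
      obtain ⟨v, hv⟩ := this
      exact ⟨v, by rw [haug]; exact congrFun hv 0⟩
  · have hz : ∀ v : Fin s → MvPolynomial V k,
        Fintype.linearCombination (MvPolynomial V k) (fun b => A 0 b) v = 0 ↔ A.mulVec v = 0 := by
      intro v
      rw [haug]
      constructor
      · intro h
        funext b
        rw [Subsingleton.elim b 0, h]
        rfl
      · intro h
        rw [h]
        rfl
    exact fun v => (hz v).trans (S.exact_next v)

/-! ### Graded Betti numbers -/

/-- The graded Betti number `β_{i,j}(I) = dim_k Tor_i^R(I, k)_j` of a homogeneous ideal `I` of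
`R = k[x_v : v ∈ V]`. As usual, `Tor` is computed from a chosen graded free resolution. -/
def gradedBetti [Finite V] (I : Ideal (MvPolynomial V k))
    (hI : I.IsHomogeneous (homogeneousSubmodule V k)) (i j : ℕ) : ℕ :=
  Module.finrank k ((exists_gradedFreeResolution I hI).some.GradedTor i j)

end

lemma edgeIdeal_isHomogeneous (k : Type*) [Field k] {V : Type*} (G : SimpleGraph V) :
    (edgeIdeal k G).IsHomogeneous (homogeneousSubmodule V k) := by
  refine Ideal.homogeneous_span _ _ ?_
  rintro _ ⟨u, v, _, rfl⟩
  exact ⟨2, (isHomogeneous_X k u).mul (isHomogeneous_X k v)⟩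

/-- `β_{i,j}(I(G))`, the graded Betti numbers of the edge ideal of `G` over the field `k`. -/
def edgeBetti (k : Type*) [Field k] {V : Type*} [Finite V] (G : SimpleGraph V) (i j : ℕ) : ℕ :=
  gradedBetti (edgeIdeal k G) (edgeIdeal_isHomogeneous k G) i j

end EdgeIdealBetti

end

/-! Tensoring the chosen resolution with the Koszul complex K gives a double complex with exact rows
and columns, so Tor_i(I(G), k)_j is the i-th homology of K ⊗ I(G) in degree j
(`finrank_gradedTor_zero`, `finrank_gradedTor_succ`). Take j = i + 2. In this degree the elements of
K_{i+1} ⊗ I(G) have linear forms of I(G) as coefficients, so they vanish, and the Betti number is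
the dimension of the space of cycles in K_i ⊗ I(G)_2 (`finrank_gradedTor_edgeIdeal`).

Over R such a cycle is the boundary of some ∑ c(u, S) x_u e_S with |S| = i + 1. No square x_u² lies
in I(G), which forces c(u, S) = 0 for u ∈ S. With U = S ∪ {u}, the remaining c(u, S) are, up to
sign, the values of a function φ_U on each set U of i + 2 vertices, and the coefficient of x_a x_b
e_T in the boundary is ±(φ_U(b) - φ_U(a)) for U = T ∪ {a, b}. So the boundary lies in I(G) iff each
φ_U is constant on the connected components of the complement of G[U], and it is zero iff each φ_U
is constant (`range_strandMap`, `koszulD_strandForm_eq_zero_iff`). For every graph the Betti number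
is therefore the sum over U of (number of components of the complement of G[U]) - 1.

If G[U] has no induced 4-cycle, any two non-edges in U meet or are joined by a third, so the
complement has at most one component with more than one vertex (`eq_of_notMem_dominating`). The
number of components is then the number of vertices dominating U, plus one if U is not a clique. The
dominating vertices add up to ∑ binom(deg v, i + 1) (`sum_card_dominating`), and non-cliques minus
all sets U gives -k_{i+2}(G). For i ≤ 1 the sets U have at most three vertices and contain no
4-cycle. -/

noncomputable section
namespace EdgeIdealBetti

open MvPolynomial

attribute [local instance] MvPolynomial.gradedAlgebra

/-! ### Homology of double complexes with exact rows and columns -/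

section DoubleComplex

variable {k : Type*} [Field k]

/-- Two subquotients that correspond to each other under a linear relation have the same
dimension. -/
lemma finrank_quotient_eq_of_relation {M N : Type*} [AddCommGroup M] [Module k M]
    [AddCommGroup N] [Module k N] (P : Submodule k (M × N))
    (Z₁ B₁ : Submodule k M) (Z₂ B₂ : Submodule k N)
    (h₁ : ∀ x, x ∈ Z₁ ↔ ∃ y, (x, y) ∈ P) (h₂ : ∀ y, y ∈ Z₂ ↔ ∃ x, (x, y) ∈ P)
    (h : ∀ x y, (x, y) ∈ P → (x ∈ B₁ ↔ y ∈ B₂)) :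
    Module.finrank k (Z₁ ⧸ B₁.submoduleOf Z₁) = Module.finrank k (Z₂ ⧸ B₂.submoduleOf Z₂) := by
  let f₁ : P →ₗ[k] Z₁ := ((LinearMap.fst k M N).comp P.subtype).codRestrict Z₁
    (fun z => (h₁ _).2 ⟨z.1.2, z.2⟩)
  let f₂ : P →ₗ[k] Z₂ := ((LinearMap.snd k M N).comp P.subtype).codRestrict Z₂
    (fun z => (h₂ _).2 ⟨z.1.1, z.2⟩)
  let g₁ := (B₁.submoduleOf Z₁).mkQ.comp f₁
  let g₂ := (B₂.submoduleOf Z₂).mkQ.comp f₂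
  have s₁ : Function.Surjective g₁ := by
    refine (Submodule.mkQ_surjective _).comp fun x => ?_
    obtain ⟨y, hy⟩ := (h₁ _).1 x.2
    exact ⟨⟨(x.1, y), hy⟩, rfl⟩
  have s₂ : Function.Surjective g₂ := by
    refine (Submodule.mkQ_surjective _).comp fun y => ?_
    obtain ⟨x, hx⟩ := (h₂ _).1 y.2
    exact ⟨⟨(x, y.1), hx⟩, rfl⟩
  have hk : LinearMap.ker g₁ = LinearMap.ker g₂ := by
    ext z
    simp only [g₁, g₂, LinearMap.mem_ker, LinearMap.comp_apply, Submodule.mkQ_apply,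
      Submodule.Quotient.mk_eq_zero]
    exact h _ _ z.2
  exact LinearEquiv.finrank_eq ((g₁.quotKerEquivOfSurjective s₁).symm.trans
    ((Submodule.quotEquivOfEq _ _ hk).trans (g₂.quotKerEquivOfSurjective s₂)))

/-- The dimension of the subquotient `Z / (Z ∩ B)`. -/
def subquotientDim {M : Type*} [AddCommGroup M] [Module k M] (Z B : Submodule k M) : ℕ :=
  Module.finrank k (Z ⧸ B.submoduleOf Z)

variable {C : ℕ → ℕ → Type*} [∀ p q, AddCommGroup (C p q)] [∀ p q, Module k (C p q)]
  (d : ∀ p q, C (p + 1) q →ₗ[k] C p q) (δ : ∀ p q, C p (q + 1) →ₗ[k] C p q)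

/-- In a double complex with exact rows and columns, the subquotients at two neighbours on an
antidiagonal have the same dimension. -/
lemma subquotientDim_step (comm : ∀ p q x, d p q (δ (p + 1) q x) = δ p q (d p (q + 1) x))
    (hd : ∀ p q, Function.Exact (d (p + 1) q) (d p q))
    (hδ : ∀ p q, Function.Exact (δ p (q + 1)) (δ p q)) (p q : ℕ) :
    subquotientDim ((LinearMap.range (d p q)).comap (δ p q))
        (LinearMap.range (d p (q + 1)) ⊔ LinearMap.range (δ p (q + 1))) =
      subquotientDim ((LinearMap.range (δ p q)).comap (d p q))
        (LinearMap.range (d (p + 1) q) ⊔ LinearMap.range (δ (p + 1) q)) := by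
  -- The relation is δ x = d y in the common target `C p q`. The squares commute rather than
  -- anticommute, so no sign enters.
  refine finrank_quotient_eq_of_relation
    (LinearMap.eqLocus ((δ p q).comp (LinearMap.fst k _ _)) ((d p q).comp (LinearMap.snd k _ _)))
    _ _ _ _ (fun x => ?_) (fun y => ?_) (fun x y hxy => ?_)
  · simp [LinearMap.mem_eqLocus, eq_comm]
  · simp [LinearMap.mem_eqLocus]
  · replace hxy : δ p q x = d p q y := hxy
    simp only [Submodule.mem_sup, LinearMap.mem_range]
    constructor
    · rintro ⟨_, ⟨a, rfl⟩, _, ⟨b, rfl⟩, rfl⟩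
      rw [map_add, (hδ p q).apply_apply_eq_zero, add_zero, ← comm] at hxy
      obtain ⟨c, hc⟩ := (hd p q (y - δ (p + 1) q a)).1 (by rw [map_sub, hxy, sub_self])
      exact ⟨_, ⟨c, rfl⟩, _, ⟨a, rfl⟩, by rw [hc, sub_add_cancel]⟩
    · rintro ⟨_, ⟨a, rfl⟩, _, ⟨b, rfl⟩, rfl⟩
      rw [map_add, (hd p q).apply_apply_eq_zero, zero_add, comm] at hxy
      obtain ⟨c, hc⟩ := (hδ p q (x - d p (q + 1) b)).1 (by rw [map_sub, hxy, sub_self])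
      exact ⟨_, ⟨b, rfl⟩, _, ⟨c, rfl⟩, by rw [hc, add_sub_cancel]⟩

/-- By exactness both sides are the kernel of the diagonal map d ∘ δ. This turns the right side of
one `subquotientDim_step` into the left side of the next. -/
lemma comap_range_eq_comap_range
    (comm : ∀ p q x, d p q (δ (p + 1) q x) = δ p q (d p (q + 1) x))
    (hd : ∀ p q, Function.Exact (d (p + 1) q) (d p q))
    (hδ : ∀ p q, Function.Exact (δ p (q + 1)) (δ p q)) (p q : ℕ) :
    (LinearMap.range (δ p (q + 1))).comap (d p (q + 1)) =
      (LinearMap.range (d (p + 1) q)).comap (δ (p + 1) q) := by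
  rw [← LinearMap.exact_iff.1 (hδ p q), ← LinearMap.exact_iff.1 (hd p q)]
  ext x
  simp [comm]

lemma subquotientDim_chain (comm : ∀ p q x, d p q (δ (p + 1) q x) = δ p q (d p (q + 1) x))
    (hd : ∀ p q, Function.Exact (d (p + 1) q) (d p q))
    (hδ : ∀ p q, Function.Exact (δ p (q + 1)) (δ p q)) (q p : ℕ) :
    subquotientDim ((LinearMap.range (d p q)).comap (δ p q))
        (LinearMap.range (d p (q + 1)) ⊔ LinearMap.range (δ p (q + 1))) =
      subquotientDim ((LinearMap.range (δ (p + q) 0)).comap (d (p + q) 0))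
        (LinearMap.range (d (p + q + 1) 0) ⊔ LinearMap.range (δ (p + q + 1) 0)) := by
  induction q generalizing p with
  | zero => exact subquotientDim_step d δ comm hd hδ p 0
  | succ q ih =>
    rw [subquotientDim_step d δ comm hd hδ p (q + 1),
      comap_range_eq_comap_range d δ comm hd hδ p q, ih (p + 1),
      show p + 1 + q = p + (q + 1) by omega]

/-- Lift a preimage under `α₁` through `ε₂` and push it down by `δ₁`; what is left of `y` is killed
by `ε₁`, hence comes from `d₁`. -/
lemma mem_range_iff_mem_sup {A₁ A₂ C₁ C₂ D₁ : Type*}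
    [AddCommGroup A₁] [Module k A₁] [AddCommGroup A₂] [Module k A₂]
    [AddCommGroup C₁] [Module k C₁] [AddCommGroup C₂] [Module k C₂]
    [AddCommGroup D₁] [Module k D₁]
    (α₁ : A₂ →ₗ[k] A₁) (δ₁ : C₂ →ₗ[k] C₁)
    (ε₁ : C₁ →ₗ[k] A₁) (ε₂ : C₂ →ₗ[k] A₂) (d₁ : D₁ →ₗ[k] C₁)
    (h₁ : Function.Exact d₁ ε₁) (s₂ : Function.Surjective ε₂)
    (c₁ : ∀ x, ε₁ (δ₁ x) = α₁ (ε₂ x)) (y : C₁) :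
    ε₁ y ∈ LinearMap.range α₁ ↔ y ∈ LinearMap.range d₁ ⊔ LinearMap.range δ₁ := by
  simp only [Submodule.mem_sup, LinearMap.mem_range]
  constructor
  · rintro ⟨a, ha⟩
    obtain ⟨c, rfl⟩ := s₂ a
    obtain ⟨b, hb⟩ := (h₁ (y - δ₁ c)).1 (by rw [map_sub, c₁, ha, sub_self])
    exact ⟨_, ⟨b, rfl⟩, _, ⟨c, rfl⟩, by rw [hb, sub_add_cancel]⟩
  · rintro ⟨_, ⟨b, rfl⟩, _, ⟨c, rfl⟩, rfl⟩
    exact ⟨ε₂ c, by rw [map_add, h₁.apply_apply_eq_zero, zero_add, c₁]⟩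

/-- The edge of a double complex with exact rows: homology of the augmentation `A₂ → A₁ → A₀`,
compared with a subquotient of `C₁`. -/
lemma subquotientDim_edge {A₀ A₁ A₂ C₀ C₁ C₂ D₀ D₁ : Type*}
    [AddCommGroup A₀] [Module k A₀] [AddCommGroup A₁] [Module k A₁] [AddCommGroup A₂] [Module k A₂]
    [AddCommGroup C₀] [Module k C₀] [AddCommGroup C₁] [Module k C₁] [AddCommGroup C₂] [Module k C₂]
    [AddCommGroup D₀] [Module k D₀] [AddCommGroup D₁] [Module k D₁]
    (α₁ : A₂ →ₗ[k] A₁) (α₀ : A₁ →ₗ[k] A₀) (δ₁ : C₂ →ₗ[k] C₁) (δ₀ : C₁ →ₗ[k] C₀)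
    (ε₀ : C₀ →ₗ[k] A₀) (ε₁ : C₁ →ₗ[k] A₁) (ε₂ : C₂ →ₗ[k] A₂)
    (d₀ : D₀ →ₗ[k] C₀) (d₁ : D₁ →ₗ[k] C₁)
    (h₀ : Function.Exact d₀ ε₀) (h₁ : Function.Exact d₁ ε₁)
    (s₁ : Function.Surjective ε₁) (s₂ : Function.Surjective ε₂)
    (c₀ : ∀ x, ε₀ (δ₀ x) = α₀ (ε₁ x)) (c₁ : ∀ x, ε₁ (δ₁ x) = α₁ (ε₂ x)) :
    subquotientDim (LinearMap.ker α₀) (LinearMap.range α₁) =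
      subquotientDim ((LinearMap.range d₀).comap δ₀)
        (LinearMap.range d₁ ⊔ LinearMap.range δ₁) := by
  -- The relation is the graph of `ε₁`, restricted to the cycles of `α₀`.
  refine finrank_quotient_eq_of_relation
    ((LinearMap.eqLocus (LinearMap.fst k _ _) (ε₁.comp (LinearMap.snd k _ _))) ⊓
      (LinearMap.ker α₀).comap (LinearMap.fst k _ _))
    _ _ _ _ (fun x => ?_) (fun y => ?_) (fun x y hxy => ?_)
  · simp only [Submodule.mem_inf, LinearMap.mem_eqLocus, Submodule.mem_comap, LinearMap.fst_apply,
      LinearMap.comp_apply, LinearMap.snd_apply, LinearMap.mem_ker]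
    constructor
    · intro h
      obtain ⟨y, rfl⟩ := s₁ x
      exact ⟨y, rfl, h⟩
    · rintro ⟨y, -, h⟩
      exact h
  · rw [← LinearMap.exact_iff.1 h₀]
    simp [LinearMap.mem_eqLocus, c₀]
  · obtain ⟨rfl, -⟩ : x = ε₁ y ∧ _ := hxy
    exact mem_range_iff_mem_sup α₁ δ₁ ε₁ ε₂ d₁ h₁ s₂ c₁ y

/-- In a double complex with exact rows and columns, the homology of the two augmentations
agrees in homological degree zero. -/
lemma finrank_augmentation_zero {A B : ℕ → Type*}
    [∀ q, AddCommGroup (A q)] [∀ q, Module k (A q)]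
    [∀ p, AddCommGroup (B p)] [∀ p, Module k (B p)]
    (α : ∀ q, A (q + 1) →ₗ[k] A q) (β : ∀ p, B (p + 1) →ₗ[k] B p)
    (ε : ∀ q, C 0 q →ₗ[k] A q) (η : ∀ p, C p 0 →ₗ[k] B p)
    (hε : ∀ q, Function.Exact (d 0 q) (ε q)) (hη : ∀ p, Function.Exact (δ p 0) (η p))
    (sε : ∀ q, Function.Surjective (ε q)) (sη : ∀ p, Function.Surjective (η p))
    (cε : ∀ q x, ε q (δ 0 q x) = α q (ε (q + 1) x))
    (cη : ∀ p x, η p (d p 0 x) = β p (η (p + 1) x)) :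
    subquotientDim ⊤ (LinearMap.range (α 0)) = subquotientDim ⊤ (LinearMap.range (β 0)) := by
  -- The pairs `(ε z, η z)` with `z` in the corner `C 0 0`: both quotients are the quotient of the
  -- corner by the sum of the two images.
  refine finrank_quotient_eq_of_relation
    (LinearMap.range ((ε 0).prod (η 0))) _ _ _ _ (fun x => ?_) (fun y => ?_) (fun x y hxy => ?_)
  · obtain ⟨z, rfl⟩ := sε 0 x
    exact iff_of_true trivial ⟨η 0 z, z, rfl⟩
  · obtain ⟨z, rfl⟩ := sη 0 y
    exact iff_of_true trivial ⟨ε 0 z, z, rfl⟩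
  · obtain ⟨z, hz⟩ := hxy
    obtain ⟨rfl, rfl⟩ := Prod.mk.inj hz
    rw [mem_range_iff_mem_sup (α 0) (δ 0 0) (ε 0) (ε 1) (d 0 0) (hε 0) (sε 1) (cε 0),
      mem_range_iff_mem_sup (β 0) (d 0 0) (η 0) (η 1) (δ 0 0) (hη 0) (sη 1) (cη 0), sup_comm]

/-- In a double complex with exact rows and columns, the homology of the two augmentations
agrees in positive homological degree. -/
lemma finrank_augmentation_succ {A B : ℕ → Type*}
    [∀ q, AddCommGroup (A q)] [∀ q, Module k (A q)]
    [∀ p, AddCommGroup (B p)] [∀ p, Module k (B p)]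
    (α : ∀ q, A (q + 1) →ₗ[k] A q) (β : ∀ p, B (p + 1) →ₗ[k] B p)
    (ε : ∀ q, C 0 q →ₗ[k] A q) (η : ∀ p, C p 0 →ₗ[k] B p)
    (comm : ∀ p q x, d p q (δ (p + 1) q x) = δ p q (d p (q + 1) x))
    (hd : ∀ p q, Function.Exact (d (p + 1) q) (d p q))
    (hδ : ∀ p q, Function.Exact (δ p (q + 1)) (δ p q))
    (hε : ∀ q, Function.Exact (d 0 q) (ε q)) (hη : ∀ p, Function.Exact (δ p 0) (η p))
    (sε : ∀ q, Function.Surjective (ε q)) (sη : ∀ p, Function.Surjective (η p))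
    (cε : ∀ q x, ε q (δ 0 q x) = α q (ε (q + 1) x))
    (cη : ∀ p x, η p (d p 0 x) = β p (η (p + 1) x)) (i : ℕ) :
    subquotientDim (LinearMap.ker (α i)) (LinearMap.range (α (i + 1))) =
      subquotientDim (LinearMap.ker (β i)) (LinearMap.range (β (i + 1))) := by
  -- Enter the antidiagonal at `C 0 (i + 1)`, walk along it to `C (i + 1) 0`, and leave on the other
  -- side, where rows and columns trade places.
  rw [subquotientDim_edge (α (i + 1)) (α i) (δ 0 (i + 1)) (δ 0 i) (ε i) (ε (i + 1)) (ε (i + 2))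
      (d 0 i) (d 0 (i + 1)) (hε i) (hε _) (sε _) (sε _) (cε _) (cε _),
    subquotientDim_chain d δ comm hd hδ i 0,
    subquotientDim_edge (β (i + 1)) (β i) (d (i + 1) 0) (d i 0) (η i) (η (i + 1)) (η (i + 2))
      (δ i 0) (δ (i + 1) 0) (hη i) (hη _) (sη _) (sη _) (cη _) (cη _), sup_comm, zero_add]

end DoubleComplex

/-! ### The Koszul complex of the polynomial ring and its contracting homotopy -/

section Koszul

variable {k : Type*} [Field k] {V : Type*} [LinearOrder V]

/-- The sign of the Koszul differential that removes `v` from `insert v S`. -/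
def koszulSign (v : V) (S : Finset V) : ℤ := (-1) ^ (S.filter (v < ·)).card

lemma koszulSign_mul_self (v : V) (S : Finset V) : koszulSign v S * koszulSign v S = 1 := by
  rw [koszulSign, ← pow_add, ← two_mul, pow_mul]
  simp

lemma koszulSign_insert_of_lt {v w : V} {S : Finset V} (hw : w ∉ S) (h : v < w) :
    koszulSign v (insert w S) = -koszulSign v S := by
  rw [koszulSign, koszulSign, Finset.filter_insert, if_pos h, Finset.card_insert_of_notMem
    (by simp [hw]), pow_succ, mul_neg_one]

lemma koszulSign_insert_of_gt {v w : V} {S : Finset V} (h : w < v) :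
    koszulSign v (insert w S) = koszulSign v S := by
  rw [koszulSign, koszulSign, Finset.filter_insert, if_neg h.not_gt]

/-- Of `v` and `w` exactly one counts the other as a later element. This sign gives d² = 0 and also
the differences in `coeff_koszulD_strandForm`. -/
lemma koszulSign_mul_insert {v w : V} {S : Finset V} (hv : v ∉ S) (hw : w ∉ S) (h : v ≠ w) :
    koszulSign w S * koszulSign v (insert w S) = -(koszulSign v S * koszulSign w (insert v S)) := by
  rcases h.lt_or_gt with h | h
  · rw [koszulSign_insert_of_lt hw h, koszulSign_insert_of_gt h]
    ring
  · rw [koszulSign_insert_of_lt hv h, koszulSign_insert_of_gt h]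
    ring

lemma koszulSign_eq_one {v : V} {S : Finset V} (h : ∀ w ∈ S, w ≤ v) : koszulSign v S = 1 := by
  rw [koszulSign, Finset.filter_false_of_mem fun w hw => (h w hw).not_gt]
  simp

/-- Keep the monomials of `p` that involve `v` but no later variable, and divide them by `v`. -/
def lastDiv (v : V) (p : MvPolynomial V k) : MvPolynomial V k :=
  AddMonoidAlgebra.ofCoeff
    ((AddMonoidAlgebra.coeff (p.divMonomial (Finsupp.single v 1))).filter
      fun μ => ∀ w ∈ μ.support, w ≤ v)

open Classical in
lemma coeff_lastDiv (v : V) (p : MvPolynomial V k) (μ : V →₀ ℕ) :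
    coeff μ (lastDiv v p) =
      if ∀ w ∈ μ.support, w ≤ v then coeff (Finsupp.single v 1 + μ) p else 0 := by
  change Finsupp.filter (fun μ : V →₀ ℕ => ∀ w ∈ μ.support, w ≤ v) _ μ = _
  rw [Finsupp.filter_apply]
  rfl

lemma lastDiv_add (v : V) (p q : MvPolynomial V k) :
    lastDiv v (p + q) = lastDiv v p + lastDiv v q := by
  classical
  ext μ
  simp only [coeff_lastDiv, coeff_add]
  split_ifs <;> simp

variable (k) in
/-- `lastDiv` as an additive map. -/
def lastDivHom (v : V) : MvPolynomial V k →+ MvPolynomial V k :=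
  AddMonoidHom.mk' (lastDiv v) (lastDiv_add v)

lemma lastDiv_zsmul (v : V) (n : ℤ) (p : MvPolynomial V k) :
    lastDiv v (n • p) = n • lastDiv v p := map_zsmul (lastDivHom k v) n p

lemma lastDiv_sum {ι : Type*} (v : V) (s : Finset ι) (f : ι → MvPolynomial V k) :
    lastDiv v (∑ i ∈ s, f i) = ∑ i ∈ s, lastDiv v (f i) := map_sum (lastDivHom k v) f s

lemma lastDiv_X_mul_of_lt {v w : V} (h : w < v) (p : MvPolynomial V k) :
    lastDiv v (X w * p) = X w * lastDiv v p := by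
  classical
  ext μ
  rw [coeff_lastDiv, coeff_X_mul', coeff_X_mul', coeff_lastDiv]
  have h1 : w ∈ (Finsupp.single v 1 + μ).support ↔ w ∈ μ.support := by
    simp [h.ne']
  simp only [h1]
  by_cases h2 : w ∈ μ.support
  · have h3 : Finsupp.single v 1 + μ - Finsupp.single w 1 =
        Finsupp.single v 1 + (μ - Finsupp.single w 1) := by
      rw [add_tsub_assoc_of_le]
      simpa [Nat.one_le_iff_ne_zero] using h2
    have h4 : (∀ u ∈ μ.support, u ≤ v) ↔ ∀ u ∈ (μ - Finsupp.single w 1).support, u ≤ v := by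
      refine ⟨fun H u hu => H u ?_, fun H u hu => ?_⟩
      · simp only [Finsupp.mem_support_iff, Finsupp.tsub_apply] at hu ⊢
        omega
      · by_cases huw : u = w
        · exact huw ▸ h.le
        · exact H u (by simpa [Finsupp.single_apply, Ne.symm huw] using hu)
    rw [if_pos h2, if_pos h2, h3]
    simp only [h4]
  · simp [h2]

lemma lastDiv_X_mul_of_gt {v w : V} (h : v < w) (p : MvPolynomial V k) :
    lastDiv v (X w * p) = 0 := by
  classical
  ext μ
  rw [coeff_lastDiv, coeff_X_mul', coeff_zero]
  split_ifs with h1 h2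
  · exact absurd (h1 w (by simpa [Finsupp.single_apply, h.ne] using h2)) h.not_ge
  · rfl
  · rfl

open Classical in
lemma coeff_lastDiv_X_mul_self (v : V) (p : MvPolynomial V k) (μ : V →₀ ℕ) :
    coeff μ (lastDiv v (X v * p)) = if ∀ w ∈ μ.support, w ≤ v then coeff μ p else 0 := by
  rw [coeff_lastDiv, coeff_X_mul]

open Classical in
lemma coeff_X_mul_lastDiv (v : V) (p : MvPolynomial V k) (μ : V →₀ ℕ) :
    coeff μ (X v * lastDiv v p) =
      if v ∈ μ.support ∧ ∀ w ∈ μ.support, w ≤ v then coeff μ p else 0 := by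
  rw [coeff_X_mul', coeff_lastDiv]
  by_cases h : v ∈ μ.support
  · have h3 : Finsupp.single v 1 + (μ - Finsupp.single v 1) = μ := by
      rw [add_tsub_cancel_of_le]
      simpa [Nat.one_le_iff_ne_zero] using h
    have h4 : (∀ u ∈ μ.support, u ≤ v) ↔ ∀ u ∈ (μ - Finsupp.single v 1).support, u ≤ v := by
      refine ⟨fun H u hu => H u ?_, fun H u hu => ?_⟩
      · simp only [Finsupp.mem_support_iff, Finsupp.tsub_apply] at hu ⊢
        omega
      · by_cases huw : u = v
        · exact huw.le
        · exact H u (by simpa [Finsupp.single_apply, Ne.symm huw] using hu)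
    rw [if_pos h, h3]
    simp only [h, true_and, ← h4]
  · simp [h]

/-- A nonconstant monomial has exactly one last variable, and `X w * lastDiv w` is the projection to
the monomials whose last variable is `w`. -/
lemma coeff_sum_X_mul_lastDiv (s : Finset V) (p : MvPolynomial V k) (μ : V →₀ ℕ)
    (hμ : μ ≠ 0) :
    coeff μ (∑ w ∈ s, X w * lastDiv w p) =
      if μ.support.max' (Finsupp.support_nonempty_iff.2 hμ) ∈ s then coeff μ p else 0 := by
  classical
  have key : ∀ w, (w ∈ μ.support ∧ ∀ u ∈ μ.support, u ≤ w) ↔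
      μ.support.max' (Finsupp.support_nonempty_iff.2 hμ) = w := fun w =>
    ⟨fun h => (Finset.max'_le _ _ _ h.2).antisymm (Finset.le_max' _ _ h.1),
      fun h => h ▸ ⟨Finset.max'_mem _ _, fun u hu => Finset.le_max' _ _ hu⟩⟩
  simp only [coeff_sum, coeff_X_mul_lastDiv, key, Finset.sum_ite_eq]

/-- A contracting homotopy of the Koszul complex in positive degrees. -/
def koszulH (f : Finset V → MvPolynomial V k) (T : Finset V) : MvPolynomial V k :=
  if h : T.Nonempty then lastDiv (T.max' h) (f (T.erase (T.max' h))) else 0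

lemma koszulH_insert {f : Finset V → MvPolynomial V k} {v : V} {S : Finset V}
    (h : ∀ w ∈ S, w < v) : koszulH f (insert v S) = lastDiv v (f S) := by
  have hm : (insert v S).max' (Finset.insert_nonempty v S) = v := by
    refine le_antisymm (Finset.max'_le _ _ _ fun w hw => ?_) (Finset.le_max' _ _ (by simp))
    rcases Finset.mem_insert.1 hw with rfl | hw
    · exact le_rfl
    · exact (h w hw).le
  rw [koszulH, dif_pos (Finset.insert_nonempty v S), hm,
    Finset.erase_insert fun hv => (h v hv).false]

variable [Fintype V]

section Differential

variable {M N : Type*} [AddCommGroup M] [Module (MvPolynomial V k) M]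
  [AddCommGroup N] [Module (MvPolynomial V k) N]

variable (k M) in
/-- The Koszul differential on the elements `∑ S, f S • e_S` of the Koszul complex of `M`. -/
def koszulD : (Finset V → M) →ₗ[MvPolynomial V k] (Finset V → M) where
  toFun f S := ∑ v ∈ Sᶜ, koszulSign v S • (X v : MvPolynomial V k) • f (insert v S)
  map_add' f g := by
    funext S
    simp [smul_add, Finset.sum_add_distrib]
  map_smul' r f := by
    funext S
    simp only [Pi.smul_apply, Finset.smul_sum, RingHom.id_apply]
    exact Finset.sum_congr rfl fun v _ => by
      rw [smul_comm (X v) r, smul_comm (koszulSign v S) r]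

lemma koszulD_apply (f : Finset V → M) (S : Finset V) :
    koszulD k M f S = ∑ v ∈ Sᶜ, koszulSign v S • (X v : MvPolynomial V k) • f (insert v S) := rfl

lemma koszulD_map (φ : M →ₗ[MvPolynomial V k] N) (f : Finset V → M) (S : Finset V) :
    koszulD k N (fun T => φ (f T)) S = φ (koszulD k M f S) := by
  simp [koszulD_apply]

lemma koszulD_koszulD (f : Finset V → M) : koszulD k M (koszulD k M f) = 0 := by
  funext S
  -- The diagonal is padded with zeros, so that the double sum runs over a square and swapping the
  -- two removed vertices is an involution on it.
  have h1 : ∀ v ∈ Sᶜ, koszulSign v S • (X v : MvPolynomial V k) • koszulD k M f (insert v S) =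
      ∑ w ∈ Sᶜ, if w = v then 0 else (koszulSign v S * koszulSign w (insert v S)) •
        (X v * X w : MvPolynomial V k) • f (insert w (insert v S)) := by
    intro v hv
    rw [koszulD_apply, Finset.smul_sum, Finset.smul_sum, Finset.compl_insert,
      ← Finset.sum_erase_add _ _ hv, if_pos rfl, add_zero]
    refine Finset.sum_congr rfl fun w hw => ?_
    rw [if_neg (Finset.ne_of_mem_erase hw), smul_comm (X v : MvPolynomial V k), smul_smul,
      smul_smul]
  rw [koszulD_apply, Finset.sum_congr rfl h1]
  simp only [Pi.zero_apply]
  rw [← Finset.sum_product']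
  refine Finset.sum_involution (fun p _ => (p.2, p.1)) ?_ ?_ ?_ ?_
  · rintro ⟨v, w⟩ hp
    simp only [Finset.mem_product, Finset.mem_compl] at hp
    by_cases h : w = v
    · simp [h]
    · simp only [if_neg h, if_neg (Ne.symm h)]
      rw [koszulSign_mul_insert hp.2 hp.1 h, mul_comm (X w : MvPolynomial V k),
        Finset.insert_comm v w, neg_smul, neg_add_cancel]
  · rintro ⟨v, w⟩ hp h0 h
    simp only [Prod.mk.injEq] at h
    exact h0 (by simp [h.1])
  · rintro ⟨v, w⟩ hp
    simp only [Finset.mem_product] at hp ⊢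
    exact hp.symm
  · rintro ⟨v, w⟩ hp
    rfl

end Differential

/-- Every monomial except the constant one has a last variable, so the homotopy identity at `∅`
fails only by the constant term. -/
lemma koszulD_koszulH_empty (f : Finset V → MvPolynomial V k) :
    koszulD k _ (koszulH f) ∅ = f ∅ - C (constantCoeff (f ∅)) := by
  classical
  have h1 : koszulD k _ (koszulH f) ∅ = ∑ w ∈ Finset.univ, X w * lastDiv w (f ∅) := by
    rw [koszulD_apply, Finset.compl_empty]
    refine Finset.sum_congr rfl fun w _ => ?_
    rw [koszulH_insert (by simp), koszulSign_eq_one (by simp), one_smul, smul_eq_mul]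
  rw [h1]
  ext μ
  by_cases hμ : μ = 0
  · subst hμ
    simp [constantCoeff_eq, coeff_sum, coeff_X_mul']
  · rw [coeff_sum_X_mul_lastDiv _ _ _ hμ, if_pos (Finset.mem_univ _), coeff_sub, coeff_C,
      if_neg (Ne.symm hμ), sub_zero]

/-- Let `v` be the last element of `T`. The contributions of `w < v` to the two summands cancel. The
term `w = v` yields the monomials of `f T` with no variable after `v`, and each `w > v` yields those
whose last variable is `w`. Together these are all monomials of `f T`. -/
lemma koszulD_koszulH_add (f : Finset V → MvPolynomial V k) {T : Finset V} (hT : T.Nonempty) :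
    koszulD k _ (koszulH f) T + koszulH (koszulD k _ f) T = f T := by
  classical
  obtain ⟨v, S, hS, rfl⟩ : ∃ v S, (∀ w ∈ S, w < v) ∧ T = insert v S :=
    ⟨T.max' hT, T.erase (T.max' hT),
      fun w hw => Finset.lt_max'_of_mem_erase_max' _ _ hw,
      (Finset.insert_erase (Finset.max'_mem _ _)).symm⟩
  have hvS : v ∉ S := fun h => (hS v h).false
  have hc : Sᶜ = insert v (insert v S)ᶜ := by
    rw [Finset.compl_insert, Finset.insert_erase (by simpa using hvS)]
  have key : ∀ w ∈ (insert v S)ᶜ,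
      koszulSign w (insert v S) • (X w : MvPolynomial V k) • koszulH f (insert w (insert v S)) +
        lastDiv v (koszulSign w S • (X w : MvPolynomial V k) • f (insert w S)) =
      if v < w then X w * lastDiv w (f (insert v S)) else 0 := by
    intro w hw
    simp only [Finset.mem_compl, Finset.mem_insert, not_or] at hw
    rw [lastDiv_zsmul, smul_eq_mul, smul_eq_mul]
    rcases lt_or_gt_of_ne hw.1 with h | h
    · rw [if_neg h.not_gt, koszulSign_insert_of_lt hvS h, Finset.insert_comm, koszulH_insert,
        lastDiv_X_mul_of_lt h, neg_smul, neg_add_cancel]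
      intro u hu
      rcases Finset.mem_insert.1 hu with rfl | hu
      · exact h
      · exact hS u hu
    · rw [if_pos h, lastDiv_X_mul_of_gt h, smul_zero, add_zero, koszulH_insert, koszulSign_eq_one,
        one_smul]
      · intro u hu
        rcases Finset.mem_insert.1 hu with rfl | hu
        · exact h.le
        · exact ((hS u hu).trans h).le
      · intro u hu
        rcases Finset.mem_insert.1 hu with rfl | hu
        · exact h
        · exact (hS u hu).trans h
  rw [koszulH_insert hS, koszulD_apply, koszulD_apply, hc,
    Finset.sum_insert (by simp), lastDiv_add, lastDiv_sum, add_left_comm, ← Finset.sum_add_distrib,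
    Finset.sum_congr rfl key, koszulSign_eq_one fun w hw => (hS w hw).le, one_smul, smul_eq_mul,
    ← Finset.sum_filter]
  ext μ
  rw [coeff_add, coeff_lastDiv_X_mul_self]
  by_cases hμ : μ = 0
  · subst hμ
    simp [coeff_sum, coeff_X_mul']
  · rw [coeff_sum_X_mul_lastDiv _ _ _ hμ]
    set m := μ.support.max' (Finsupp.support_nonempty_iff.2 hμ) with hm
    have h1 : (∀ w ∈ μ.support, w ≤ v) ↔ m ≤ v := (Finset.max'_le_iff _ _).symm
    have h2 : m ∈ (insert v S)ᶜ.filter (v < ·) ↔ v < m := by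
      simp only [Finset.mem_filter, Finset.mem_compl, Finset.mem_insert, not_or,
        and_iff_right_iff_imp]
      exact fun h => ⟨h.ne', fun h' => (hS m h').not_gt h⟩
    simp only [h1, h2]
    by_cases h : v < m
    · simp [h]
    · simp [h, not_lt.1 h]

/-- Exactness of the Koszul complex of the polynomial ring in positive degrees. -/
lemma exists_koszulD_eq (f : Finset V → MvPolynomial V k) (hf : koszulD k _ f = 0)
    (h0 : constantCoeff (f ∅) = 0) : ∃ g, koszulD k _ g = f := by
  refine ⟨koszulH f, funext fun T => ?_⟩
  rcases T.eq_empty_or_nonempty with rfl | hT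
  · rw [koszulD_koszulH_empty, h0, C_0, sub_zero]
  · have h1 : koszulH (0 : Finset V → MvPolynomial V k) T = 0 := by
      rw [koszulH, dif_pos hT]
      exact map_zero (lastDivHom k (T.max' hT))
    rw [← koszulD_koszulH_add f hT, hf, h1, add_zero]

end Koszul

/-! ### Graded pieces of Koszul complexes -/

section Cells

variable {k : Type*} [Field k] {V : Type*}

variable (k V) in
/-- The projections of a graded module `M` to the degree `j` parts of its shifts `M(-p)`, for a
fixed `j`. -/
structure ShiftedComponents (M : Type*) [AddCommGroup M] [Module k M]
    [Module (MvPolynomial V k) M] where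
  /-- the projection to the degree `j` part of `M(-p)` -/
  comp : ℕ → M →ₗ[k] M
  comp_X_smul : ∀ p (v : V) x, comp p ((X v : MvPolynomial V k) • x) =
    (X v : MvPolynomial V k) • comp (p + 1) x
  comp_comp : ∀ p x, comp p (comp p x) = comp p x

lemma shiftComp_add (a m : ℕ) (p q : MvPolynomial V k) :
    shiftComp a m (p + q) = shiftComp a m p + shiftComp a m q := by
  unfold shiftComp
  split_ifs <;> simp

lemma shiftComp_smul (a m : ℕ) (r : k) (p : MvPolynomial V k) :
    shiftComp a m (r • p) = r • shiftComp a m p := by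
  unfold shiftComp
  split_ifs <;> simp

lemma shiftComp_shiftComp (a m : ℕ) (p : MvPolynomial V k) :
    shiftComp a m (shiftComp a m p) = shiftComp a m p := by
  unfold shiftComp
  split_ifs
  · rw [homogeneousComponent_of_mem (homogeneousComponent_mem _ _), if_pos rfl]
  · rfl

lemma shiftComp_eq_self {a m e : ℕ} {p : MvPolynomial V k} (hp : p.IsHomogeneous e)
    (h : a + e = m) : shiftComp a m p = p := by
  rw [shiftComp, if_pos (by omega), show m - a = e by omega, homogeneousComponent_of_mem hp,
    if_pos rfl]

lemma constantCoeff_shiftComp (a m : ℕ) (p : MvPolynomial V k) (h : a ≠ m) :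
    constantCoeff (shiftComp a m p) = 0 := by
  unfold shiftComp
  split_ifs with h1
  · rw [constantCoeff_eq, coeff_homogeneousComponent, if_neg]
    simp only [map_zero]
    omega
  · simp

lemma shiftComp_X_mul (a m : ℕ) (v : V) (p : MvPolynomial V k) :
    shiftComp a m (X v * p) = X v * shiftComp (a + 1) m p :=
  shiftComp_mul (isHomogeneous_X k v) rfl

variable (k V) in
/-- The degree `j` parts of the shifts of a graded free module. -/
def freeComponents {ι : Type*} (D : ι → ℕ) (j : ℕ) :
    ShiftedComponents k V (ι → MvPolynomial V k) where
  comp p :=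
    { toFun := fun x b => shiftComp (p + D b) j (x b)
      map_add' := fun x y => funext fun b => shiftComp_add _ _ _ _
      map_smul' := fun r x => funext fun b => shiftComp_smul _ _ _ _ }
  comp_X_smul p v x := funext fun b => by
    simp only [LinearMap.coe_mk, AddHom.coe_mk, Pi.smul_apply, smul_eq_mul, shiftComp_X_mul]
    rw [show p + D b + 1 = p + 1 + D b by omega]
  comp_comp p x := funext fun b => shiftComp_shiftComp _ _ _

variable (k V) in
/-- The degree `j` parts of the shifts of the polynomial ring. -/
def ringComponents (j : ℕ) : ShiftedComponents k V (MvPolynomial V k) where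
  comp p :=
    { toFun := fun x => shiftComp p j x
      map_add' := fun _ _ => shiftComp_add _ _ _ _
      map_smul' := fun _ _ => shiftComp_smul _ _ _ _ }
  comp_X_smul _ _ _ := shiftComp_X_mul _ _ _ _
  comp_comp _ _ := shiftComp_shiftComp _ _ _

variable {M N L : Type*} [AddCommGroup M] [Module k M] [Module (MvPolynomial V k) M]
  [AddCommGroup N] [Module k N] [Module (MvPolynomial V k) N]
  [AddCommGroup L] [Module k L] [Module (MvPolynomial V k) L]

/-- The projection to the part of the Koszul complex of `M` in homological degree `p` and internal
degree `j`. -/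
def koszulProj (c : ShiftedComponents k V M) (p : ℕ) (f : Finset V → M) (S : Finset V) : M :=
  if S.card = p then c.comp p (f S) else 0

/-- The part of the Koszul complex of `M` in homological degree `p` and internal degree `j`. -/
def koszulCell (c : ShiftedComponents k V M) (p : ℕ) : Submodule k (Finset V → M) where
  carrier := {f | ∀ S, koszulProj c p f S = f S}
  add_mem' {f g} hf hg S := by
    rw [Pi.add_apply, ← hf, ← hg]
    unfold koszulProj
    split_ifs <;> simp
  zero_mem' S := by
    simp [koszulProj]
  smul_mem' r f hf S := by
    rw [Pi.smul_apply, ← hf]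
    unfold koszulProj
    split_ifs <;> simp

lemma koszulProj_mem (c : ShiftedComponents k V M) (p : ℕ) (f : Finset V → M) :
    koszulProj c p f ∈ koszulCell c p := by
  intro S
  simp only [koszulProj]
  split_ifs
  · exact c.comp_comp _ _
  · rfl

lemma koszulCell.eq_zero {c : ShiftedComponents k V M} {p : ℕ} {f : Finset V → M}
    (hf : f ∈ koszulCell c p) {S : Finset V} (hS : S.card ≠ p) : f S = 0 := by
  rw [← hf S, koszulProj, if_neg hS]

lemma koszulProj_map (c : ShiftedComponents k V M) (c' : ShiftedComponents k V N)
    (φ : M →ₗ[MvPolynomial V k] N) (hφ : ∀ p x, φ (c.comp p x) = c'.comp p (φ x)) (p : ℕ)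
    (f : Finset V → M) (S : Finset V) :
    koszulProj c' p (fun T => φ (f T)) S = φ (koszulProj c p f S) := by
  unfold koszulProj
  split_ifs
  · exact (hφ _ _).symm
  · simp

/-- The map between parts of Koszul complexes induced by a homogeneous map. -/
def koszulCellMap [IsScalarTower k (MvPolynomial V k) M] [IsScalarTower k (MvPolynomial V k) N]
    (c : ShiftedComponents k V M) (c' : ShiftedComponents k V N)
    (φ : M →ₗ[MvPolynomial V k] N) (hφ : ∀ p x, φ (c.comp p x) = c'.comp p (φ x)) (p : ℕ) :
    koszulCell c p →ₗ[k] koszulCell c' p where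
  toFun f := ⟨fun S => φ (f.1 S), fun S => by rw [koszulProj_map c c' φ hφ, f.2 S]⟩
  map_add' f g := by ext; simp
  map_smul' r f := by
    ext S
    exact (φ.restrictScalars k).map_smul r _

/-- Exactness holds coefficientwise; a preimage chosen without regard to degree is made homogeneous
by `koszulProj`, which commutes with the maps. -/
lemma koszulCellMap_exact [IsScalarTower k (MvPolynomial V k) M]
    [IsScalarTower k (MvPolynomial V k) N] [IsScalarTower k (MvPolynomial V k) L]
    (c : ShiftedComponents k V M) (c' : ShiftedComponents k V N) (c'' : ShiftedComponents k V L)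
    (φ : M →ₗ[MvPolynomial V k] N) (hφ : ∀ p x, φ (c.comp p x) = c'.comp p (φ x))
    (ψ : N →ₗ[MvPolynomial V k] L) (hψ : ∀ p x, ψ (c'.comp p x) = c''.comp p (ψ x))
    (h : Function.Exact φ ψ) (p : ℕ) :
    Function.Exact (koszulCellMap c c' φ hφ p) (koszulCellMap c' c'' ψ hψ p) := by
  intro f
  constructor
  · intro hf
    have h1 : ∀ S, ψ (f.1 S) = 0 := fun S => congrFun (congrArg Subtype.val hf) S
    choose g hg using fun S => (h (f.1 S)).1 (h1 S)
    refine ⟨⟨koszulProj c p g, koszulProj_mem c p g⟩, Subtype.ext (funext fun S => ?_)⟩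
    change φ (koszulProj c p g S) = f.1 S
    rw [← koszulProj_map c c' φ hφ, funext hg, f.2 S]
  · rintro ⟨g, rfl⟩
    exact Subtype.ext (funext fun S => h.apply_apply_eq_zero _)

section Differential

variable [LinearOrder V] [Fintype V]

/-- The differential lowers the exterior degree by one and multiplies by a variable, so it preserves
the internal degree. Hence preimages under it can be made homogeneous. -/
lemma koszulD_koszulProj (c : ShiftedComponents k V M) (p : ℕ) (f : Finset V → M) :
    koszulD k M (koszulProj c (p + 1) f) = koszulProj c p (koszulD k M f) := by
  funext S
  rw [koszulProj, koszulD_apply, koszulD_apply]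
  split_ifs with h
  · rw [map_sum]
    refine Finset.sum_congr rfl fun v hv => ?_
    rw [koszulProj, if_pos, map_zsmul, c.comp_X_smul]
    rw [Finset.card_insert_of_notMem (by simpa using hv), h]
  · refine Finset.sum_eq_zero fun v hv => ?_
    rw [koszulProj, if_neg, smul_zero, smul_zero]
    rw [Finset.card_insert_of_notMem (by simpa using hv)]
    omega

lemma koszulD_mem {c : ShiftedComponents k V M} {p : ℕ} {f : Finset V → M}
    (hf : f ∈ koszulCell c (p + 1)) : koszulD k M f ∈ koszulCell c p := by
  intro S
  rw [← koszulD_koszulProj, show koszulProj c (p + 1) f = f from funext hf]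

lemma koszulD_eq_zero_of_mem {c : ShiftedComponents k V M} {f : Finset V → M}
    (hf : f ∈ koszulCell c 0) : koszulD k M f = 0 := by
  funext S
  rw [koszulD_apply]
  refine Finset.sum_eq_zero fun v _ => ?_
  rw [koszulCell.eq_zero hf (by simp), smul_zero, smul_zero]

variable [IsScalarTower k (MvPolynomial V k) M] [IsScalarTower k (MvPolynomial V k) N]

/-- The Koszul differential on the part of internal degree `j`. -/
def koszulCellD (c : ShiftedComponents k V M) (p : ℕ) :
    koszulCell c (p + 1) →ₗ[k] koszulCell c p :=
  ((koszulD k M).restrictScalars k).restrict fun _ hf => koszulD_mem hf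

lemma koszulCellD_koszulCellMap (c : ShiftedComponents k V M) (c' : ShiftedComponents k V N)
    (φ : M →ₗ[MvPolynomial V k] N) (hφ : ∀ p x, φ (c.comp p x) = c'.comp p (φ x)) (p : ℕ)
    (f : koszulCell c (p + 1)) :
    koszulCellD c' p (koszulCellMap c c' φ hφ (p + 1) f) =
      koszulCellMap c c' φ hφ p (koszulCellD c p f) :=
  Subtype.ext (funext fun S => koszulD_map φ f.1 S)

variable {ι : Type*}

/-- In each coordinate this is the Koszul complex of the ring, where `exists_koszulD_eq` applies;
projecting the preimage to the right degree does not change its image. -/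
lemma exists_koszulCellD_eq (D : ι → ℕ) (j : ℕ) (p : ℕ)
    (f : koszulCell (freeComponents k V D j) p) (hf : koszulD k _ f.1 = 0)
    (h0 : ∀ b, constantCoeff (f.1 ∅ b) = 0) :
    ∃ g, koszulCellD (freeComponents k V D j) p g = f := by
  let pr (b : ι) : (ι → MvPolynomial V k) →ₗ[MvPolynomial V k] MvPolynomial V k :=
    LinearMap.proj b
  have h1 : ∀ b, ∃ g : Finset V → MvPolynomial V k, koszulD k _ g = fun S => f.1 S b := fun b =>
    exists_koszulD_eq _ (funext fun S => by
      refine (koszulD_map (pr b) f.1 S).trans ?_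
      rw [hf]
      rfl) (h0 b)
  choose g hg using h1
  refine ⟨⟨_, koszulProj_mem _ _ fun S b => g b S⟩, Subtype.ext ?_⟩
  change koszulD k _ (koszulProj _ _ _) = f.1
  rw [koszulD_koszulProj]
  have : koszulD k _ (fun S b => g b S) = f.1 := by
    funext S b
    rw [← congrFun (hg b) S]
    exact (koszulD_map (pr b) (fun S b => g b S) S).symm
  rw [this]
  exact funext f.2

lemma koszulCellD_exact (D : ι → ℕ) (j : ℕ) (p : ℕ) :
    Function.Exact (koszulCellD (freeComponents k V D j) (p + 1))
      (koszulCellD (freeComponents k V D j) p) := by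
  intro f
  constructor
  · intro hf
    refine exists_koszulCellD_eq D j (p + 1) f (congrArg Subtype.val hf) fun b => ?_
    -- In positive exterior degree the coefficient at `∅` is zero, so the condition on constant
    -- terms is automatic.
    rw [koszulCell.eq_zero f.2 (by simp)]
    simp
  · rintro ⟨g, rfl⟩
    exact Subtype.ext (koszulD_koszulD g.1)

end Differential

/-- The augmentation of the degree `j` part of the Koszul complex of a graded free module. -/
def koszulAug {ι : Type*} (D : ι → ℕ) (j : ℕ) :
    koszulCell (freeComponents k V D j) 0 →ₗ[k] ({b // D b = j} → k) where
  toFun f b := constantCoeff (f.1 ∅ b)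
  map_add' f g := by funext b; simp
  map_smul' r f := by funext b; simp [constantCoeff_eq]

lemma koszulAug_surjective {ι : Type*} (D : ι → ℕ) (j : ℕ) :
    Function.Surjective (koszulAug D j : koszulCell (freeComponents k V D j) 0 →ₗ[k] _) := by
  classical
  intro a
  refine ⟨⟨fun S b => if h : S = ∅ ∧ D b = j then C (a ⟨b, h.2⟩) else 0, fun S => ?_⟩, ?_⟩
  · funext b
    by_cases h : S = ∅ ∧ D b = j
    · simp only [koszulProj, h.1, Finset.card_empty, if_true, freeComponents,
        LinearMap.coe_mk, AddHom.coe_mk, true_and]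
      rw [dif_pos h.2]
      exact shiftComp_eq_self (isHomogeneous_C _ _) (show 0 + D b + 0 = j by have := h.2; omega)
    · simp only [dif_neg h, koszulProj]
      split_ifs
      · simp [freeComponents, dif_neg h, shiftComp]
      · rfl
  · funext b
    simp [koszulAug, b.2]

lemma koszulCell.constantCoeff_eq_zero {ι : Type*} {D : ι → ℕ} {j : ℕ}
    (f : koszulCell (freeComponents k V D j) 0) {b : ι} (h : D b ≠ j) :
    constantCoeff (f.1 ∅ b) = 0 := by
  rw [← f.2 ∅]
  simp only [koszulProj, Finset.card_empty]
  exact constantCoeff_shiftComp _ _ _ (by omega)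

/-- For degree reasons only basis elements with `D b = j` can carry a constant term, so the kernel
of the augmentation consists of the elements without constant terms. -/
lemma koszulAug_exact [LinearOrder V] [Fintype V] {ι : Type*} (D : ι → ℕ) (j : ℕ) :
    Function.Exact (koszulCellD (freeComponents k V D j) 0)
      (koszulAug D j : koszulCell (freeComponents k V D j) 0 →ₗ[k] _) := by
  intro f
  constructor
  · intro hf
    refine exists_koszulCellD_eq D j 0 f (koszulD_eq_zero_of_mem f.2) fun b => ?_
    by_cases h : D b = j
    · exact congrFun hf ⟨b, h⟩
    · exact koszulCell.constantCoeff_eq_zero f h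
  · rintro ⟨g, rfl⟩
    funext b
    change constantCoeff (koszulD k _ g.1 ∅ b) = 0
    rw [koszulD_apply]
    simp

end Cells

/-! ### Tor from the Koszul complex of the ideal -/

section Comparison

variable {k : Type*} [Field k] {V : Type*} {I : Ideal (MvPolynomial V k)}

lemma mulVecLin_freeComponents {r s : ℕ} {d : Fin r → ℕ} {e : Fin s → ℕ}
    {A : Matrix (Fin r) (Fin s) (MvPolynomial V k)} (hA : IsGradedMatrix d e A) (j p : ℕ)
    (x : Fin s → MvPolynomial V k) :
    A.mulVecLin ((freeComponents k V e j).comp p x) =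
      (freeComponents k V d j).comp p (A.mulVecLin x) := by
  refine mulVec_vecComp (d := fun b => p + d b) (e := fun b => p + e b) (fun b c => ?_) j x
  refine (hA b c).imp id ?_
  rintro ⟨m, h1, h2⟩
  exact ⟨m, h1, by rw [add_assoc, h2]⟩

lemma linearCombination_freeComponents {r : ℕ} {d : Fin r → ℕ} {a : Fin r → MvPolynomial V k}
    (ha : ∀ b, (a b).IsHomogeneous (d b)) (j p : ℕ) (x : Fin r → MvPolynomial V k) :
    Fintype.linearCombination (MvPolynomial V k) a ((freeComponents k V d j).comp p x) =
      (ringComponents k V j).comp p (Fintype.linearCombination (MvPolynomial V k) a x) := by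
  simp only [Fintype.linearCombination_apply, smul_eq_mul]
  rw [map_sum]
  refine Finset.sum_congr rfl fun b _ => ?_
  rw [mul_comm, mul_comm (x b)]
  exact (shiftComp_mul (ha b) rfl).symm

/-- The part of the Koszul complex of `I` in homological degree `p` and internal degree `j`. -/
def koszulIdeal (I : Ideal (MvPolynomial V k)) (j p : ℕ) :
    Submodule k (Finset V → MvPolynomial V k) :=
  koszulCell (ringComponents k V j) p ⊓
    Submodule.pi Set.univ fun _ => I.restrictScalars k

lemma mem_koszulIdeal {j p : ℕ} {f : Finset V → MvPolynomial V k} :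
    f ∈ koszulIdeal I j p ↔ f ∈ koszulCell (ringComponents k V j) p ∧ ∀ S, f S ∈ I := by
  simp [koszulIdeal, Submodule.mem_pi]

namespace GradedFreeResolution

variable (F : GradedFreeResolution I) (j : ℕ)

/-- The part of `K_p ⊗ F_q` of internal degree `j`. -/
abbrev gridCell (p q : ℕ) : Submodule k (Finset V → Fin (F.rank q) → MvPolynomial V k) :=
  koszulCell (freeComponents k V (F.deg q) j) p

/-- The differential of `K ⊗ F` induced by the differential of `F`. -/
def gridDiff (p q : ℕ) : F.gridCell j p (q + 1) →ₗ[k] F.gridCell j p q :=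
  koszulCellMap _ _ (F.diff q).mulVecLin (mulVecLin_freeComponents (F.diff_homogeneous q) j) p

lemma range_aug : LinearMap.range (Fintype.linearCombination (MvPolynomial V k) F.aug) = I :=
  (Fintype.range_linearCombination _ F.aug).trans F.span_aug

lemma linearCombination_aug_mem (x : Fin (F.rank 0) → MvPolynomial V k) :
    Fintype.linearCombination (MvPolynomial V k) F.aug x ∈ I :=
  F.range_aug.le (LinearMap.mem_range_self _ _)

/-- The map from `K ⊗ F_0` to `K ⊗ R` induced by the augmentation of `F`. -/
def gridAugRing (p : ℕ) : F.gridCell j p 0 →ₗ[k] koszulCell (ringComponents k V j) p :=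
  koszulCellMap _ _ (Fintype.linearCombination (MvPolynomial V k) F.aug)
    (linearCombination_freeComponents F.aug_homogeneous j) p

/-- The map from `K ⊗ F_0` to `K ⊗ I` induced by the augmentation of `F`. -/
def gridAug (p : ℕ) : F.gridCell j p 0 →ₗ[k] koszulIdeal I j p :=
  ((koszulCell _ _).subtype.comp (F.gridAugRing j p)).codRestrict _ fun f =>
    mem_koszulIdeal.2 ⟨(F.gridAugRing j p f).2, fun _ => F.linearCombination_aug_mem _⟩

lemma gridAug_surjective (p : ℕ) : Function.Surjective (F.gridAug j p) := by
  intro f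
  obtain ⟨h1, h2⟩ := mem_koszulIdeal.1 f.2
  have h3 : ∀ S, ∃ x, Fintype.linearCombination (MvPolynomial V k) F.aug x = f.1 S := fun S =>
    F.range_aug.ge (h2 S)
  choose g hg using h3
  refine ⟨⟨_, koszulProj_mem _ _ g⟩, Subtype.ext (funext fun S => ?_)⟩
  change Fintype.linearCombination (MvPolynomial V k) F.aug (koszulProj _ p g S) = f.1 S
  rw [← koszulProj_map _ (ringComponents k V j) _
    (linearCombination_freeComponents F.aug_homogeneous j), funext hg, h1 S]

lemma gridAug_exact (p : ℕ) : Function.Exact (F.gridDiff j p 0) (F.gridAug j p) := by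
  intro f
  refine Iff.trans ?_ (koszulCellMap_exact _ _ _ _
    (mulVecLin_freeComponents (F.diff_homogeneous 0) j) _
    (linearCombination_freeComponents F.aug_homogeneous j) F.exact_zero p f)
  constructor <;> intro h <;> have h' := congrArg Subtype.val h <;> exact Subtype.ext h'

lemma gridDiff_exact (p q : ℕ) : Function.Exact (F.gridDiff j p (q + 1)) (F.gridDiff j p q) :=
  koszulCellMap_exact _ _ _ _ _ _ _ (F.exact_succ q) p

/-- Taking constant terms is a ring homomorphism, and the basis elements of degree other than `j`,
which `fiberDiff` omits, contribute no constant term. -/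
lemma koszulAug_gridDiff (q : ℕ) (f : F.gridCell j 0 (q + 1)) :
    koszulAug (F.deg q) j (F.gridDiff j 0 q f) =
      F.fiberDiff q j (koszulAug (F.deg (q + 1)) j f) := by
  classical
  funext b
  change constantCoeff (∑ c, F.diff q b c * f.1 ∅ c) = ∑ c : {c // F.deg (q + 1) c = j},
    constantCoeff (F.diff q b c) * constantCoeff (f.1 ∅ c)
  rw [map_sum, ← Finset.sum_subtype (Finset.univ.filter fun c => F.deg (q + 1) c = j)
    (fun c => by simp) fun c => constantCoeff (F.diff q b c) * constantCoeff (f.1 ∅ c),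
    Finset.sum_filter_of_ne]
  · simp only [map_mul]
  · intro c _ hc
    by_contra h
    exact hc (by rw [koszulCell.constantCoeff_eq_zero f h, mul_zero])

end GradedFreeResolution

variable [LinearOrder V] [Fintype V]

lemma koszulD_mem_koszulIdeal {j p : ℕ} {f : Finset V → MvPolynomial V k}
    (hf : f ∈ koszulIdeal I j (p + 1)) : koszulD k _ f ∈ koszulIdeal I j p := by
  rw [mem_koszulIdeal] at hf ⊢
  refine ⟨koszulD_mem hf.1, fun S => ?_⟩
  rw [koszulD_apply]
  exact Submodule.sum_mem _ fun v _ => I.toAddSubgroup.zsmul_mem (I.mul_mem_left _ (hf.2 _)) _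

variable (I) in
/-- The Koszul differential of `I` in internal degree `j`. -/
def koszulIdealD (j p : ℕ) : koszulIdeal I j (p + 1) →ₗ[k] koszulIdeal I j p :=
  ((koszulD k _).restrictScalars k).restrict fun _ hf => koszulD_mem_koszulIdeal hf

namespace GradedFreeResolution

variable (F : GradedFreeResolution I) (j : ℕ)

lemma gridAug_koszulCellD (p : ℕ) (f : F.gridCell j (p + 1) 0) :
    F.gridAug j p (koszulCellD (freeComponents k V (F.deg 0) j) p f) =
      koszulIdealD I j p (F.gridAug j (p + 1) f) :=
  Subtype.ext (funext fun S =>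
    (koszulD_map (Fintype.linearCombination (MvPolynomial V k) F.aug) f.1 S).symm)

/-- The graded Betti numbers can be computed from the Koszul complex. -/
lemma finrank_gradedTor_zero :
    Module.finrank k (F.GradedTor 0 j) =
      subquotientDim ⊤ (LinearMap.range (koszulIdealD I j 0)) :=
  finrank_augmentation_zero (C := fun p q => F.gridCell j p q) (A := fun q => F.Fiber q j)
    (B := fun p => koszulIdeal I j p)
    (fun p q => koszulCellD (freeComponents k V (F.deg q) j) p) (F.gridDiff j)
    (fun q => F.fiberDiff q j) (koszulIdealD I j)
    (fun q => koszulAug (F.deg q) j) (F.gridAug j)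
    (fun _ => koszulAug_exact _ _) (F.gridAug_exact j)
    (fun _ => koszulAug_surjective _ _) (F.gridAug_surjective j)
    (F.koszulAug_gridDiff j)
    (F.gridAug_koszulCellD j)

/-- The graded Betti numbers can be computed from the Koszul complex. -/
lemma finrank_gradedTor_succ (i : ℕ) :
    Module.finrank k (F.GradedTor (i + 1) j) =
      subquotientDim (LinearMap.ker (koszulIdealD I j i))
        (LinearMap.range (koszulIdealD I j (i + 1))) :=
  finrank_augmentation_succ (C := fun p q => F.gridCell j p q) (A := fun q => F.Fiber q j)
    (B := fun p => koszulIdeal I j p)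
    (fun p q => koszulCellD (freeComponents k V (F.deg q) j) p) (F.gridDiff j)
    (fun q => F.fiberDiff q j) (koszulIdealD I j)
    (fun q => koszulAug (F.deg q) j) (F.gridAug j)
    (fun _ _ f => koszulCellD_koszulCellMap _ _ _ _ _ f)
    (fun _ _ => koszulCellD_exact _ _ _) (F.gridDiff_exact j)
    (fun _ => koszulAug_exact _ _) (F.gridAug_exact j)
    (fun _ => koszulAug_surjective _ _) (F.gridAug_surjective j)
    (F.koszulAug_gridDiff j)
    (F.gridAug_koszulCellD j) i

end GradedFreeResolution

end Comparison

/-! ### The linear strand of the edge ideal -/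

section LinearStrand

variable {k : Type*} [Field k] {V : Type*}

/-- The edge ideal is a monomial ideal, so membership is decided monomial by monomial. -/
lemma mem_edgeIdeal_iff_support (G : SimpleGraph V) (p : MvPolynomial V k) :
    p ∈ edgeIdeal k G ↔ ∀ μ ∈ p.support, ∃ a b, G.Adj a b ∧
      Finsupp.single a 1 + Finsupp.single b 1 ≤ μ := by
  have h : {p : MvPolynomial V k | ∃ u v : V, G.Adj u v ∧ p = X u * X v} =
      (fun s => monomial s (1 : k)) ''
        {s | ∃ a b, G.Adj a b ∧ s = Finsupp.single a 1 + Finsupp.single b 1} := by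
    ext p
    constructor
    · rintro ⟨u, v, huv, rfl⟩
      exact ⟨_, ⟨u, v, huv, rfl⟩, by simp [X, monomial_mul]⟩
    · rintro ⟨_, ⟨u, v, huv, rfl⟩, rfl⟩
      exact ⟨u, v, huv, by simp [X, monomial_mul]⟩
  rw [edgeIdeal, h, mem_ideal_span_monomial_image]
  refine forall₂_congr fun μ _ => ⟨?_, ?_⟩
  · rintro ⟨_, ⟨a, b, hab, rfl⟩, hle⟩
    exact ⟨a, b, hab, hle⟩
  · rintro ⟨a, b, hab, hle⟩
    exact ⟨_, ⟨a, b, hab, rfl⟩, hle⟩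

lemma degree_single_add_single (a b : V) :
    (Finsupp.single a 1 + Finsupp.single b 1 : V →₀ ℕ).degree = 2 := by
  simp

/-- An edge monomial that divides a monomial of degree two is equal to it. The case `a = b` is
included: squares do not occur in the edge ideal. -/
lemma coeff_eq_zero_of_mem_edgeIdeal {G : SimpleGraph V} {p : MvPolynomial V k}
    (hp : p ∈ edgeIdeal k G) {a b : V} (h : ¬ G.Adj a b) :
    coeff (Finsupp.single a 1 + Finsupp.single b 1) p = 0 := by
  by_contra h0
  obtain ⟨u, v, huv, hle⟩ := (mem_edgeIdeal_iff_support G p).1 hp _ (mem_support_iff.2 h0)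
  have heq : (Finsupp.single u 1 + Finsupp.single v 1 : V →₀ ℕ) =
      Finsupp.single a 1 + Finsupp.single b 1 := by
    obtain ⟨ν, hν⟩ := exists_add_of_le hle
    have h1 := congrArg Finsupp.degree hν
    rw [map_add _ _ ν, degree_single_add_single, degree_single_add_single] at h1
    have h2 : ν = 0 := (Finsupp.degree_eq_zero_iff ν).1 (by omega)
    rw [hν, h2, add_zero]
  have hu := DFunLike.congr_fun heq u
  have hv := DFunLike.congr_fun heq v
  classical
  simp only [Finsupp.add_apply, Finsupp.single_apply, if_neg huv.ne, if_neg huv.ne', if_true]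
    at hu hv
  by_cases hau : a = u
  · by_cases hbv : b = v
    · exact h (hau ▸ hbv ▸ huv)
    · rw [if_neg hbv] at hv
      split_ifs at hv with h3
      exact huv.ne (hau.symm.trans h3)
  · rw [if_neg hau] at hu
    split_ifs at hu with h3
    · by_cases hav : a = v
      · exact h (h3 ▸ hav ▸ huv.symm)
      · rw [if_neg hav] at hv
        split_ifs at hv with h4
        exact huv.ne (h3.symm.trans h4)

lemma exists_eq_single_add {μ : V →₀ ℕ} {n : ℕ} (h : μ.degree = n + 1) :
    ∃ a ν, μ = Finsupp.single a 1 + ν ∧ ν.degree = n := by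
  have h1 : ∃ a, μ a ≠ 0 := by
    by_contra! h0
    have : μ = 0 := Finsupp.ext h0
    simp [this] at h
  obtain ⟨a, ha⟩ := h1
  obtain ⟨ν, rfl⟩ := exists_add_of_le (show Finsupp.single a 1 ≤ μ by
    simpa [Nat.one_le_iff_ne_zero] using ha)
  refine ⟨a, ν, rfl, ?_⟩
  rw [map_add, Finsupp.degree_single] at h
  omega

lemma exists_eq_single {μ : V →₀ ℕ} (h : μ.degree = 1) : ∃ a, μ = Finsupp.single a 1 := by
  obtain ⟨a, ν, rfl, h2⟩ := exists_eq_single_add h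
  exact ⟨a, by rw [(Finsupp.degree_eq_zero_iff ν).1 h2, add_zero]⟩

lemma exists_eq_single_add_single {μ : V →₀ ℕ} (h : μ.degree = 2) :
    ∃ a b, μ = Finsupp.single a 1 + Finsupp.single b 1 := by
  obtain ⟨a, ν, rfl, h2⟩ := exists_eq_single_add h
  obtain ⟨b, rfl⟩ := exists_eq_single h2
  exact ⟨a, b, rfl⟩

lemma mem_edgeIdeal_of_coeff {G : SimpleGraph V} {p : MvPolynomial V k} (hp : p.IsHomogeneous 2)
    (h : ∀ a b, ¬ G.Adj a b → coeff (Finsupp.single a 1 + Finsupp.single b 1) p = 0) :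
    p ∈ edgeIdeal k G := by
  rw [mem_edgeIdeal_iff_support]
  intro μ hμ
  have h2 : μ.degree = 2 := by
    by_contra h0
    exact mem_support_iff.1 hμ (hp.coeff_eq_zero h0)
  obtain ⟨a, b, rfl⟩ := exists_eq_single_add_single h2
  exact ⟨a, b, by_contra fun h0 => mem_support_iff.1 hμ (h a b h0), le_rfl⟩

lemma edgeIdeal_bot : edgeIdeal k (⊥ : SimpleGraph V) = ⊥ := by
  simp [edgeIdeal]

lemma eq_zero_of_mem_edgeIdeal {G : SimpleGraph V} {p : MvPolynomial V k} {n : ℕ}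
    (hp : p ∈ edgeIdeal k G) (hn : p.IsHomogeneous n) (h : n < 2) : p = 0 := by
  ext μ
  rw [coeff_zero]
  by_contra h0
  obtain ⟨a, b, -, hle⟩ := (mem_edgeIdeal_iff_support G p).1 hp μ (mem_support_iff.2 h0)
  have h1 : μ.degree = n := by
    by_contra h2
    exact h0 (hn.coeff_eq_zero h2)
  have := Finsupp.degree_mono hle
  rw [degree_single_add_single] at this
  omega

lemma isHomogeneous_of_mem_koszulCell {f : Finset V → MvPolynomial V k} {p e : ℕ}
    (hf : f ∈ koszulCell (ringComponents k V (p + e)) p) {S : Finset V} (hS : S.card = p) :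
    (f S).IsHomogeneous e := by
  rw [← hf S, koszulProj, if_pos hS]
  change (shiftComp p (p + e) (f S)).IsHomogeneous e
  rw [shiftComp, if_pos (by omega), Nat.add_sub_cancel_left]
  exact homogeneousComponent_isHomogeneous _ _

lemma mem_koszulCell_of_isHomogeneous {f : Finset V → MvPolynomial V k} {p e : ℕ}
    (h0 : ∀ S, S.card ≠ p → f S = 0) (h1 : ∀ S, S.card = p → (f S).IsHomogeneous e) :
    f ∈ koszulCell (ringComponents k V (p + e)) p := by
  intro S
  rw [koszulProj]
  split_ifs with hS
  · exact shiftComp_eq_self (h1 S hS) rfl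
  · exact (h0 S hS).symm

/-- The coefficients here are linear forms, while the ideal is generated in degree two. Hence there
are no boundaries in the linear strand. -/
lemma koszulIdeal_edgeIdeal_eq_bot (G : SimpleGraph V) (i : ℕ) :
    koszulIdeal (edgeIdeal k G) (i + 2) (i + 1) = ⊥ := by
  rw [eq_bot_iff]
  intro f hf
  obtain ⟨h1, h2⟩ := mem_koszulIdeal.1 hf
  refine (Submodule.mem_bot k).2 (funext fun S => ?_)
  by_cases hS : S.card = i + 1
  · exact eq_zero_of_mem_edgeIdeal (h2 S)
      (isHomogeneous_of_mem_koszulCell (p := i + 1) (e := 1) h1 hS) one_lt_two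
  · exact koszulCell.eq_zero h1 hS

/-- Families of functions `φ U` on the sets `U` of `m` vertices that take the same value at
vertices that are not adjacent. -/
def nonedgeConstant (k : Type*) [Field k] (G : SimpleGraph V) (m : ℕ) :
    Submodule k (Finset V → V → k) where
  carrier := {φ | (∀ U u, φ U u ≠ 0 → U.card = m ∧ u ∈ U) ∧
    ∀ U, ∀ a ∈ U, ∀ b ∈ U, ¬ G.Adj a b → φ U a = φ U b}
  add_mem' {φ ψ} hφ hψ := by
    refine ⟨fun U u h => ?_, fun U a ha b hb h => ?_⟩
    · by_cases h0 : φ U u = 0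
      · exact hψ.1 U u fun h1 => h (by simp [h0, h1])
      · exact hφ.1 U u h0
    · simp [hφ.2 U a ha b hb h, hψ.2 U a ha b hb h]
  zero_mem' := ⟨fun U u h => absurd rfl h, fun _ _ _ _ _ _ => rfl⟩
  smul_mem' r φ hφ := by
    refine ⟨fun U u h => hφ.1 U u fun h0 => h (by simp [h0]), fun U a ha b hb h => ?_⟩
    simp [hφ.2 U a ha b hb h]

variable [LinearOrder V]

lemma sign_smul_eq_zero {v w : V} {S T : Finset V} {x : k} :
    (koszulSign v S * koszulSign w T) • x = 0 ↔ x = 0 := by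
  refine ⟨fun h => ?_, fun h => by rw [h, smul_zero]⟩
  have h1 := congrArg ((koszulSign v S * koszulSign w T) • ·) h
  simp only [smul_smul, smul_zero] at h1
  rwa [mul_mul_mul_comm, koszulSign_mul_self, koszulSign_mul_self, one_mul, one_smul] at h1

variable [Fintype V]

section Coefficients

open Finsupp (single)

lemma coeff_single_add_single_koszulD (g : Finset V → MvPolynomial V k) (T : Finset V) {a b : V}
    (hab : a ≠ b) :
    coeff (single a 1 + single b 1) (koszulD k _ g T) =
      (if a ∈ T then 0 else koszulSign a T • coeff (single b 1) (g (insert a T))) +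
        (if b ∈ T then 0 else koszulSign b T • coeff (single a 1) (g (insert b T))) := by
  have key : ∀ v, coeff (single a 1 + single b 1) (koszulSign v T • (X v : MvPolynomial V k) •
      g (insert v T)) = (if v = a then koszulSign a T • coeff (single b 1) (g (insert a T)) else 0) +
        (if v = b then koszulSign b T • coeff (single a 1) (g (insert b T)) else 0) := by
    intro v
    rw [smul_eq_mul, ← Int.cast_smul_eq_zsmul k, coeff_smul]
    by_cases hva : v = a
    · subst hva
      rw [if_pos rfl, if_neg hab, coeff_X_mul, add_zero, smul_eq_mul, zsmul_eq_mul]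
    · by_cases hvb : v = b
      · subst hvb
        rw [if_neg hva, if_pos rfl, add_comm (single a 1), coeff_X_mul, zero_add, smul_eq_mul,
          zsmul_eq_mul]
      · rw [if_neg hva, if_neg hvb, coeff_X_mul', if_neg, smul_zero, add_zero]
        simp [Ne.symm hva, Ne.symm hvb]
  rw [koszulD_apply, coeff_sum]
  simp only [key, Finset.sum_add_distrib, Finset.sum_ite_eq', Finset.mem_compl, ite_not]

lemma coeff_single_add_self_koszulD (g : Finset V → MvPolynomial V k) (T : Finset V) (a : V) :
    coeff (single a 1 + single a 1) (koszulD k _ g T) =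
      if a ∈ T then 0 else koszulSign a T • coeff (single a 1) (g (insert a T)) := by
  have key : ∀ v, coeff (single a 1 + single a 1) (koszulSign v T • (X v : MvPolynomial V k) •
      g (insert v T)) =
        (if v = a then koszulSign a T • coeff (single a 1) (g (insert a T)) else 0) := by
    intro v
    rw [smul_eq_mul, ← Int.cast_smul_eq_zsmul k, coeff_smul]
    by_cases hva : v = a
    · subst hva
      rw [if_pos rfl, coeff_X_mul, smul_eq_mul, zsmul_eq_mul]
    · rw [if_neg hva, coeff_X_mul', if_neg, smul_zero]
      simp [Ne.symm hva]
  rw [koszulD_apply, coeff_sum]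
  simp only [key, Finset.sum_ite_eq', Finset.mem_compl, ite_not]

/-- The linear forms with coefficients `± φ (insert u S) u`. -/
def strandForm (φ : Finset V → V → k) (S : Finset V) : MvPolynomial V k :=
  ∑ u ∈ Sᶜ, monomial (single u 1) (koszulSign u S • φ (insert u S) u)

lemma coeff_strandForm (φ : Finset V → V → k) (S : Finset V) (b : V) :
    coeff (single b 1) (strandForm φ S) =
      if b ∈ S then 0 else koszulSign b S • φ (insert b S) b := by
  rw [strandForm, coeff_sum]
  have key : ∀ u, coeff (single b 1) (monomial (single u 1) (koszulSign u S • φ (insert u S) u)) =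
      if u = b then koszulSign b S • φ (insert b S) b else 0 := by
    intro u
    simp only [coeff_monomial, Finsupp.single_left_inj one_ne_zero]
    split_ifs with h
    · rw [h]
    · rfl
  simp only [key, Finset.sum_ite_eq', Finset.mem_compl, ite_not]

lemma isHomogeneous_strandForm (φ : Finset V → V → k) (S : Finset V) :
    (strandForm φ S).IsHomogeneous 1 :=
  IsHomogeneous.sum _ _ _ fun u _ => isHomogeneous_monomial _ (by simp)

/-- The monomial arises by removing `a` or by removing `b` from `T ∪ {a, b}`, and these two
contributions have opposite signs. -/
lemma coeff_koszulD_strandForm (φ : Finset V → V → k) (T : Finset V) {a b : V} (hab : a ≠ b)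
    (ha : a ∉ T) (hb : b ∉ T) :
    coeff (single a 1 + single b 1) (koszulD k _ (strandForm φ) T) =
      (koszulSign a T * koszulSign b (insert a T)) •
        (φ (insert a (insert b T)) b - φ (insert a (insert b T)) a) := by
  rw [coeff_single_add_single_koszulD _ _ hab, if_neg ha, if_neg hb, coeff_strandForm,
    coeff_strandForm, if_neg (by simp [hab.symm, hb]), if_neg (by simp [hab, ha]), smul_smul,
    smul_smul, koszulSign_mul_insert ha hb hab, Finset.insert_comm b a, neg_smul, smul_sub,
    sub_eq_add_neg]

lemma coeff_koszulD_strandForm_eq_zero (φ : Finset V → V → k) (T : Finset V) {a b : V}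
    (h : a = b ∨ a ∈ T ∨ b ∈ T) :
    coeff (single a 1 + single b 1) (koszulD k _ (strandForm φ) T) = 0 := by
  by_cases hab : a = b
  · subst hab
    rw [coeff_single_add_self_koszulD, coeff_strandForm]
    simp
  · rw [coeff_single_add_single_koszulD _ _ hab, coeff_strandForm, coeff_strandForm]
    rcases h.resolve_left hab with h | h <;> simp [h]

lemma strandForm_add (φ ψ : Finset V → V → k) :
    strandForm (φ + ψ) = strandForm φ + strandForm ψ := by
  funext S
  simp [strandForm, Finset.sum_add_distrib]

lemma strandForm_smul (r : k) (φ : Finset V → V → k) :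
    strandForm (r • φ) = r • strandForm φ := by
  funext S
  simp only [strandForm, Pi.smul_apply, Finset.smul_sum, smul_monomial]
  exact Finset.sum_congr rfl fun u _ => by rw [smul_comm]

lemma isHomogeneous_koszulD_strandForm (φ : Finset V → V → k) (T : Finset V) :
    (koszulD k _ (strandForm φ) T).IsHomogeneous 2 :=
  IsHomogeneous.sum _ _ _ fun u _ => (homogeneousSubmodule V k 2).toAddSubgroup.zsmul_mem
    ((isHomogeneous_X k u).mul (isHomogeneous_strandForm φ _)) _

lemma koszulD_strandForm_mem {G : SimpleGraph V} {m : ℕ} {φ : Finset V → V → k}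
    (hφ : φ ∈ nonedgeConstant k G m) (T : Finset V) :
    koszulD k _ (strandForm φ) T ∈ edgeIdeal k G := by
  refine mem_edgeIdeal_of_coeff (isHomogeneous_koszulD_strandForm φ T) fun a b h => ?_
  by_cases h0 : a = b ∨ a ∈ T ∨ b ∈ T
  · exact coeff_koszulD_strandForm_eq_zero φ T h0
  · simp only [not_or] at h0
    rw [coeff_koszulD_strandForm φ T h0.1 h0.2.1 h0.2.2,
      hφ.2 _ b (by simp) a (by simp) fun h1 => h h1.symm, sub_self, smul_zero]

/-- Vanishing is membership in the edge ideal of the edgeless graph, for which every pair is a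
non-edge and each `φ U` must be constant on `U`. -/
lemma koszulD_strandForm_eq_zero_iff {G : SimpleGraph V} {m : ℕ} {φ : Finset V → V → k}
    (hφ : φ ∈ nonedgeConstant k G m) :
    koszulD k _ (strandForm φ) = 0 ↔ φ ∈ nonedgeConstant k (⊥ : SimpleGraph V) m := by
  constructor
  · intro h
    refine ⟨hφ.1, fun U a ha b hb _ => ?_⟩
    by_cases hab : a = b
    · rw [hab]
    · have h1 := coeff_koszulD_strandForm φ ((U.erase b).erase a) hab (by simp) (by simp)
      rw [h, Pi.zero_apply, coeff_zero, eq_comm, sign_smul_eq_zero,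
        Finset.insert_comm a b, Finset.insert_erase (by simp [ha, hab]), Finset.insert_erase hb] at h1
      exact (sub_eq_zero.1 h1).symm
  · intro h
    funext T
    have := koszulD_strandForm_mem h T
    rwa [edgeIdeal_bot] at this

end Coefficients

lemma strandForm_mem {φ : Finset V → V → k} {i : ℕ}
    (hφ : ∀ U u, φ U u ≠ 0 → U.card = i + 2 ∧ u ∈ U) :
    strandForm φ ∈ koszulCell (ringComponents k V (i + 2)) (i + 1) := by
  refine mem_koszulCell_of_isHomogeneous (p := i + 1) (e := 1) (fun S hS => ?_)
    fun S _ => isHomogeneous_strandForm φ S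
  refine Finset.sum_eq_zero fun u hu => ?_
  have : φ (insert u S) u = 0 := by
    by_contra h
    have := (hφ _ _ h).1
    rw [Finset.card_insert_of_notMem (by simpa using hu)] at this
    omega
  rw [this, smul_zero, monomial_zero]

/-- The Koszul cycles of the edge ideal in the linear strand that correspond to families of
functions. -/
def strandMap (G : SimpleGraph V) (i : ℕ) :
    nonedgeConstant k G (i + 2) →ₗ[k] koszulIdeal (edgeIdeal k G) (i + 2) i where
  toFun φ := ⟨koszulD k _ (strandForm φ.1), mem_koszulIdeal.2
    ⟨koszulD_mem (strandForm_mem φ.2.1), koszulD_strandForm_mem φ.2⟩⟩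
  map_add' φ ψ := Subtype.ext (by simp [strandForm_add])
  map_smul' r φ := Subtype.ext (by
    simp only [Submodule.coe_smul, strandForm_smul, RingHom.id_apply]
    exact ((koszulD k _).restrictScalars k).map_smul r _)

lemma finrank_ker_strandMap (G : SimpleGraph V) (i : ℕ) :
    Module.finrank k (LinearMap.ker (strandMap (k := k) G i)) =
      Module.finrank k (nonedgeConstant k (⊥ : SimpleGraph V) (i + 2)) := by
  have hle : nonedgeConstant k (⊥ : SimpleGraph V) (i + 2) ≤ nonedgeConstant k G (i + 2) :=
    fun φ hφ => ⟨hφ.1, fun U a ha b hb _ => hφ.2 U a ha b hb (by simp)⟩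
  have hk : LinearMap.ker (strandMap (k := k) G i) =
      (nonedgeConstant k (⊥ : SimpleGraph V) (i + 2)).comap (nonedgeConstant k G (i + 2)).subtype := by
    ext φ
    rw [Submodule.mem_comap, Submodule.subtype_apply, ← koszulD_strandForm_eq_zero_iff φ.2,
      LinearMap.mem_ker]
    exact Subtype.ext_iff
  rw [hk]
  exact (Submodule.comapSubtypeEquivOfLe hle).finrank_eq

/-- The Koszul cycles of the edge ideal in the linear strand. -/
def strandCycles (k : Type*) [Field k] (G : SimpleGraph V) (i : ℕ) :
    Submodule k (koszulIdeal (edgeIdeal k G) (i + 2) i) :=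
  (LinearMap.ker ((koszulD k (MvPolynomial V k)).restrictScalars k)).comap (Submodule.subtype _)

lemma mem_strandCycles {G : SimpleGraph V} {i : ℕ}
    {f : koszulIdeal (edgeIdeal k G) (i + 2) i} :
    f ∈ strandCycles k G i ↔ koszulD k _ f.1 = 0 := Iff.rfl

/-- A cycle with coefficients in the ideal is a boundary over the ring, of some `g` with linear
coefficients. The squares missing from the ideal show that `g` is a `strandForm`; the missing
non-edges make its family constant along non-edges. -/
lemma range_strandMap (G : SimpleGraph V) (i : ℕ) :
    LinearMap.range (strandMap (k := k) G i) = strandCycles k G i := by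
  apply le_antisymm
  · rintro _ ⟨φ, rfl⟩
    exact koszulD_koszulD _
  · intro f hf
    obtain ⟨hf1, hf2⟩ := mem_koszulIdeal.1 f.2
    have h0 : constantCoeff (f.1 ∅) = 0 := by
      by_cases hi : i = 0
      · subst hi
        have := isHomogeneous_of_mem_koszulCell (p := 0) (e := 2) hf1 (S := ∅) rfl
        exact this.coeff_eq_zero (by simp)
      · rw [koszulCell.eq_zero hf1 (by simpa using Ne.symm hi), map_zero]
    obtain ⟨g', hg'⟩ := exists_koszulD_eq f.1 hf h0
    obtain ⟨g, hg, hgf⟩ : ∃ g ∈ koszulCell (ringComponents k V (i + 2)) (i + 1),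
        koszulD k _ g = f.1 :=
      ⟨_, koszulProj_mem _ _ g', by rw [koszulD_koszulProj, hg']; exact funext hf1⟩
    have hc : ∀ T a b, ¬ G.Adj a b →
        coeff (Finsupp.single a 1 + Finsupp.single b 1) (koszulD k _ g T) = 0 := fun T a b h =>
      coeff_eq_zero_of_mem_edgeIdeal (hgf ▸ hf2 T) h
    -- The coefficient of `x_u²` in the boundary at `S.erase u` is, up to sign, the coefficient of
    -- `x_u` in `g S`.
    have hg0 : ∀ S u, u ∈ S → coeff (Finsupp.single u 1) (g S) = 0 := by
      intro S u hu
      have := hc (S.erase u) u u (G.irrefl)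
      rw [coeff_single_add_self_koszulD, if_neg (by simp), Finset.insert_erase hu] at this
      -- The second sign is taken at `∅`, where it is 1, since `sign_smul_eq_zero` is about a
      -- product of two signs.
      simpa using (sign_smul_eq_zero (v := u) (w := u) (S := S.erase u) (T := ∅)).1 (by
        rw [koszulSign_eq_one (S := ∅) (by simp), mul_one, this])
    -- The sign is its own inverse, so this undoes the one in `strandForm`; outside the allowed
    -- pairs the value must be zero.
    let φ : Finset V → V → k := fun U u =>
      if U.card = i + 2 ∧ u ∈ U then
        koszulSign u (U.erase u) • coeff (Finsupp.single u 1) (g (U.erase u)) else 0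
    have hφg : strandForm φ = g := by
      funext S
      by_cases hS : S.card = i + 1
      · have hom := isHomogeneous_of_mem_koszulCell (p := i + 1) (e := 1) hg hS
        ext μ
        by_cases hμ : μ.degree = 1
        · obtain ⟨u, rfl⟩ := exists_eq_single hμ
          rw [coeff_strandForm]
          split_ifs with hu
          · exact (hg0 S u hu).symm
          · simp only [φ, Finset.card_insert_of_notMem hu, hS, Finset.mem_insert_self, and_self,
              if_true, Finset.erase_insert hu, smul_smul, koszulSign_mul_self, one_smul]
        · rw [(isHomogeneous_strandForm φ S).coeff_eq_zero hμ, hom.coeff_eq_zero hμ]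
      · rw [koszulCell.eq_zero hg hS, koszulCell.eq_zero (strandForm_mem (i := i) ?_) hS]
        intro U u h
        by_contra h1
        exact h (if_neg h1)
    have hφ1 : ∀ U u, φ U u ≠ 0 → U.card = i + 2 ∧ u ∈ U := fun U u h => by
      by_contra h1
      exact h (if_neg h1)
    have hφ : φ ∈ nonedgeConstant k G (i + 2) := by
      refine ⟨hφ1, fun U a ha b hb h => ?_⟩
      by_cases hab : a = b
      · rw [hab]
      · have h1 := coeff_koszulD_strandForm φ ((U.erase b).erase a) hab (by simp) (by simp)
        rw [hφg, hc _ _ _ h, eq_comm, sign_smul_eq_zero, Finset.insert_comm a b,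
          Finset.insert_erase (by simp [ha, hab]), Finset.insert_erase hb] at h1
        exact (sub_eq_zero.1 h1).symm
    exact ⟨⟨φ, hφ⟩, Subtype.ext (by rw [← hgf, ← hφg]; rfl)⟩

lemma finrank_strandCycles (G : SimpleGraph V) (i : ℕ) :
    Module.finrank k (strandCycles k G i) +
        Module.finrank k (nonedgeConstant k (⊥ : SimpleGraph V) (i + 2)) =
      Module.finrank k (nonedgeConstant k G (i + 2)) := by
  rw [← range_strandMap, ← finrank_ker_strandMap G i]
  exact LinearMap.finrank_range_add_finrank_ker _

/-- With no boundaries present, the homology is the space of cycles itself. -/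
lemma finrank_gradedTor_edgeIdeal (G : SimpleGraph V)
    (F : GradedFreeResolution (edgeIdeal k G)) (i : ℕ) :
    Module.finrank k (F.GradedTor i (i + 2)) = Module.finrank k (strandCycles k G i) := by
  have hb : LinearMap.range (koszulIdealD (edgeIdeal k G) (i + 2) i) = ⊥ := by
    rw [eq_bot_iff]
    rintro _ ⟨f, rfl⟩
    have : f = 0 := Subtype.ext
      ((Submodule.mem_bot k).1 ((koszulIdeal_edgeIdeal_eq_bot (k := k) G i).le f.2))
    rw [this, map_zero]
    exact Submodule.zero_mem _
  have hq : ∀ Z : Submodule k (koszulIdeal (edgeIdeal k G) (i + 2) i),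
      subquotientDim Z ⊥ = Module.finrank k Z := fun Z => by
    rw [subquotientDim]
    exact (Submodule.quotEquivOfEqBot _ (by simp [Submodule.submoduleOf])).finrank_eq
  cases i with
  | zero =>
    -- The Koszul differential vanishes in exterior degree zero, so all elements are cycles, as in
    -- the definition of `cycles`.
    have hz : strandCycles k G 0 = ⊤ :=
      eq_top_iff.2 fun f _ => koszulD_eq_zero_of_mem (mem_koszulIdeal.1 f.2).1
    rw [F.finrank_gradedTor_zero, hb, hq, hz]
  | succ i =>
    have hz : strandCycles k G (i + 1) =
        LinearMap.ker (koszulIdealD (edgeIdeal k G) (i + 1 + 2) i) := by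
      ext f
      rw [mem_strandCycles, LinearMap.mem_ker]
      refine ⟨fun h => Subtype.ext h, fun h => ?_⟩
      have h' := congrArg Subtype.val h
      exact h'
    rw [F.finrank_gradedTor_succ, hb, hq, hz]

end LinearStrand

/-! ### Counting components of complements -/

section Counting

variable {k : Type*} [Field k] {V : Type*}

open Classical in
/-- The vertices in `U` that are adjacent to all other vertices in `U`. -/
def dominating (G : SimpleGraph V) (U : Finset V) : Finset V :=
  {u ∈ U | ∀ v ∈ U, v ≠ u → G.Adj u v}

lemma mem_dominating {G : SimpleGraph V} {U : Finset V} {u : V} :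
    u ∈ dominating G U ↔ u ∈ U ∧ ∀ v ∈ U, v ≠ u → G.Adj u v := by
  simp [dominating]

lemma dominating_eq_self_iff {G : SimpleGraph V} {U : Finset V} :
    dominating G U = U ↔ G.IsClique U := by
  rw [Finset.ext_iff, SimpleGraph.isClique_iff]
  simp only [mem_dominating, and_iff_left_iff_imp]
  exact ⟨fun h a ha b hb hab => h a ha b hb hab.symm, fun h a ha b hb hab => h ha hb hab.symm⟩

/-- `U` does not contain an induced 4-cycle `a b a' b'`. -/
def FourCycleFreeOn (G : SimpleGraph V) (U : Finset V) : Prop :=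
  ∀ a ∈ U, ∀ a' ∈ U, ∀ b ∈ U, ∀ b' ∈ U, a ≠ a' → b ≠ b' → ¬ G.Adj a a' → ¬ G.Adj b b' →
    G.Adj a b → G.Adj a b' → G.Adj a' b → G.Adj a' b' → False

/-- Pick non-neighbours `a'` of `a` and `b'` of `b` in `U`. A non-edge between `{a, a'}` and `{b,
b'}` carries the value across; without one, `a b a' b'` would be an induced 4-cycle. -/
lemma eq_of_notMem_dominating {G : SimpleGraph V} {m : ℕ} {φ : Finset V → V → k}
    (hφ : φ ∈ nonedgeConstant k G m) {U : Finset V} (hU : FourCycleFreeOn G U) {a b : V}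
    (ha : a ∈ U) (hb : b ∈ U) (ha' : a ∉ dominating G U) (hb' : b ∉ dominating G U) :
    φ U a = φ U b := by
  simp only [mem_dominating, ha, hb, true_and, not_forall] at ha' hb'
  obtain ⟨a', ha'U, ha'a, haa'⟩ := ha'
  obtain ⟨b', hb'U, hb'b, hbb'⟩ := hb'
  have h1 := hφ.2 U a ha a' ha'U haa'
  have h2 := hφ.2 U b hb b' hb'U hbb'
  by_cases c1 : G.Adj a b
  · by_cases c2 : G.Adj a b'
    · by_cases c3 : G.Adj a' b
      · by_cases c4 : G.Adj a' b'
        · exact (hU a ha a' ha'U b hb b' hb'U ha'a.symm hb'b.symm haa' hbb' c1 c2 c3 c4).elim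
        · rw [h1, h2, hφ.2 U a' ha'U b' hb'U c4]
      · rw [h1, hφ.2 U a' ha'U b hb c3]
    · rw [h2, hφ.2 U a ha b' hb'U c2]
  · exact hφ.2 U a ha b hb c1

lemma FourCycleFreeOn.of_card_le_three {G : SimpleGraph V} {U : Finset V} (hU : U.card ≤ 3) :
    FourCycleFreeOn G U := by
  classical
  intro a ha a' ha' b hb b' hb' h1 h2 _ _ h3 h4 h5 h6
  have hs : ({a, a', b, b'} : Finset V) ⊆ U := by
    simp [Finset.insert_subset_iff, ha, ha', hb, hb']
  have hc : ({a, a', b, b'} : Finset V).card = 4 := by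
    rw [Finset.card_insert_of_notMem, Finset.card_insert_of_notMem, Finset.card_pair h2] <;>
      simp [h1, h3.ne, h4.ne, h5.ne, h6.ne]
  have := Finset.card_le_card hs
  omega

lemma FourCycleFreeOn.of_noInducedFourCycle {G : SimpleGraph V} (hG : NoInducedFourCycle G)
    (U : Finset V) : FourCycleFreeOn G U := by
  intro a _ a' _ b _ b' _ h1 h2 h3 h4 h5 h6 h7 h8
  let f : SimpleGraph.cycleGraph 4 ↪g G :=
    -- The list goes round the cycle, so the non-edges `a a'` and `b b'` are its diagonals.
    { toFun := ![a, b, a', b']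
      inj' := by
        intro x y
        have := h5.ne
        have := h6.ne
        have := h7.ne
        have := h8.ne
        fin_cases x <;> fin_cases y <;> simp_all [eq_comm]
      map_rel_iff' := by
        intro x y
        change G.Adj (![a, b, a', b'] x) (![a, b, a', b'] y) ↔ _
        rw [SimpleGraph.cycleGraph_adj]
        have h3' := mt SimpleGraph.Adj.symm h3
        have h4' := mt SimpleGraph.Adj.symm h4
        fin_cases x <;> fin_cases y <;>
          simp [h3, h4, h3', h4', h5, h6, h7, h8, h5.symm, h6.symm, h7.symm, h8.symm] <;> decide }
  refine hG (Finset.univ.map f.toEmbedding) (by simp) ?_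
  have hr : ((Finset.univ.map f.toEmbedding : Finset V) : Set V) = Set.range f := by simp
  rw [hr]
  exact ⟨f.isoInduceRange.symm⟩

lemma completeCount_eq_ncard (m : ℕ) (G : SimpleGraph V) :
    completeCount m G = {S : Finset V | S.card = m ∧ G.IsClique S}.ncard := by
  rw [completeCount, inducedCount]
  congr 1
  ext S
  simp only [Set.mem_ofPred_eq]
  constructor
  · rintro ⟨e⟩
    refine ⟨by simpa using Fintype.card_congr e.toEquiv, ?_⟩
    rw [SimpleGraph.isClique_iff]
    intro a ha b hb hab
    have : G.induce (S : Set V) |>.Adj ⟨a, ha⟩ ⟨b, hb⟩ := by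
      rw [← e.map_adj_iff]
      simpa using hab
    exact this
  · rintro ⟨h1, h2⟩
    rw [SimpleGraph.induce_eq_top.2 h2]
    exact ⟨SimpleGraph.Iso.completeGraph (S.equivFinOfCardEq h1)⟩

variable [Fintype V]

/-- The dimension of the space of families of functions that are constant along non-edges. -/
lemma finrank_nonedgeConstant (G : SimpleGraph V) (m : ℕ)
    [DecidablePred fun U : Finset V => G.IsClique (U : Set V)]
    (h : ∀ U : Finset V, U.card = m → FourCycleFreeOn G U) :
    Module.finrank k (nonedgeConstant k G m) =
      ∑ U ∈ Finset.powersetCard m Finset.univ, (dominating G U).card +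
        (({U ∈ Finset.powersetCard m Finset.univ | ¬ G.IsClique U} : Finset (Finset V))).card := by
  classical
  set s₁ := (Finset.powersetCard m (Finset.univ : Finset V)).sigma (dominating G) with hs₁
  set s₂ := ({U ∈ Finset.powersetCard m Finset.univ | ¬ G.IsClique U} : Finset (Finset V)) with hs₂
  have hs₂' : ∀ U : s₂, ∃ u ∈ U.1, u ∉ dominating G U.1 := by
    rintro ⟨U, hU⟩
    have h1 := (Finset.mem_filter.1 hU).2
    rw [← dominating_eq_self_iff] at h1
    by_contra! h2
    exact h1 (Finset.Subset.antisymm (fun u hu => (mem_dominating.1 hu).1) h2)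
  choose r hr hr' using hs₂'
  -- Coordinates on the space: for each `U`, the value at every dominating vertex, and, if `U` is
  -- not a clique, the common value at the other vertices, read off at the representative `r U`.
  let ev : nonedgeConstant k G m →ₗ[k] (s₁ ⊕ s₂ → k) :=
    { toFun := fun φ => Sum.elim (fun p => φ.1 p.1.1 p.1.2) (fun U => φ.1 U.1 (r U))
      map_add' := fun φ ψ => by ext x; cases x <;> rfl
      map_smul' := fun c φ => by ext x; cases x <;> rfl }
  have hcard : ∀ U : s₂, U.1.card = m := fun U =>
    (Finset.mem_powersetCard.1 (Finset.mem_filter.1 U.2).1).2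
  have hmem : ∀ {U : Finset V} {u : V}, U.card = m → u ∈ dominating G U → (⟨U, u⟩ : Σ _, V) ∈ s₁ :=
    fun hU hu => Finset.mem_sigma.2 ⟨Finset.mem_powersetCard.2 ⟨Finset.subset_univ _, hU⟩, hu⟩
  have hmem' : ∀ {U : Finset V} {u : V}, U.card = m → u ∈ U → u ∉ dominating G U → U ∈ s₂ :=
    fun hU hu hu' => Finset.mem_filter.2
      ⟨Finset.mem_powersetCard.2 ⟨Finset.subset_univ _, hU⟩, fun hc =>
        hu' ((dominating_eq_self_iff.2 hc).symm ▸ hu)⟩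
  have hinj : Function.Injective ev := by
    rw [← LinearMap.ker_eq_bot, LinearMap.ker_eq_bot']
    intro φ hφ
    refine Subtype.ext (funext fun U => funext fun u => ?_)
    by_contra h0
    obtain ⟨hU, hu⟩ := φ.2.1 U u h0
    by_cases hd : u ∈ dominating G U
    · exact h0 (congrFun hφ (Sum.inl ⟨⟨U, u⟩, hmem hU hd⟩))
    · have hU' := hmem' hU hu hd
      rw [eq_of_notMem_dominating φ.2 (h U hU) hu (hr ⟨U, hU'⟩) hd (hr' ⟨U, hU'⟩)] at h0
      exact h0 (congrFun hφ (Sum.inr ⟨U, hU'⟩))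
  have hsurj : Function.Surjective ev := by
    intro x
    let φ : Finset V → V → k := fun U u =>
      if h1 : (⟨U, u⟩ : Σ _, V) ∈ s₁ then x (Sum.inl ⟨_, h1⟩)
      else if h2 : U ∈ s₂ ∧ u ∈ U then x (Sum.inr ⟨U, h2.1⟩) else 0
    have hφd : ∀ U u (hU : U.card = m) (hu : u ∈ dominating G U),
        φ U u = x (Sum.inl ⟨⟨U, u⟩, hmem hU hu⟩) := fun U u hU hu => dif_pos (hmem hU hu)
    have hφn : ∀ (U : s₂) u, u ∈ U.1 → u ∉ dominating G U.1 → φ U.1 u = x (Sum.inr U) :=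
      fun U u hu hu' => by
        simp only [φ]
        rw [dif_neg fun h1 => hu' (Finset.mem_sigma.1 h1).2, dif_pos ⟨U.2, hu⟩]
    have hφ : φ ∈ nonedgeConstant k G m := by
      have hφ1 : ∀ U u, φ U u ≠ 0 → U.card = m ∧ u ∈ U := by
        intro U u h0
        by_cases h1 : (⟨U, u⟩ : Σ _, V) ∈ s₁
        · obtain ⟨h2, h3⟩ := Finset.mem_sigma.1 h1
          exact ⟨(Finset.mem_powersetCard.1 h2).2, (mem_dominating.1 h3).1⟩
        · by_cases h2 : U ∈ s₂ ∧ u ∈ U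
          · exact ⟨hcard ⟨U, h2.1⟩, h2.2⟩
          · simp [φ, h1, h2] at h0
      refine ⟨hφ1, fun U a ha b hb hab => ?_⟩
      by_cases hU : U.card = m
      · by_cases hne : a = b
        · rw [hne]
        · have ha' : a ∉ dominating G U := fun hd =>
            hab ((mem_dominating.1 hd).2 b hb (Ne.symm hne))
          have hb' : b ∉ dominating G U := fun hd =>
            hab ((mem_dominating.1 hd).2 a ha hne).symm
          rw [hφn ⟨U, hmem' hU ha ha'⟩ a ha ha', hφn ⟨U, hmem' hU ha ha'⟩ b hb hb']
      · have hz : ∀ u, φ U u = 0 := fun u => by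
          by_contra h0
          exact hU (hφ1 U u h0).1
        rw [hz, hz]
    refine ⟨⟨φ, hφ⟩, funext fun y => ?_⟩
    rcases y with ⟨⟨U, u⟩, hy⟩ | U
    · exact dif_pos hy
    · exact hφn U _ (hr U) (hr' U)
  rw [(LinearEquiv.ofBijective ev ⟨hinj, hsurj⟩).finrank_eq, Module.finrank_fintype_fun_eq_card,
    Fintype.card_sum, Fintype.card_coe, Fintype.card_coe, hs₁, Finset.card_sigma]

/-- Double counting: removing `v` matches the sets of `i + 1` vertices dominated by `v` with the
sets of `i` neighbours of `v`. -/
lemma sum_card_dominating (G : SimpleGraph V) [DecidableRel G.Adj] (i : ℕ) :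
    ∑ U ∈ Finset.powersetCard (i + 1) Finset.univ, (dominating G U).card =
      ∑ v : V, (G.degree v).choose i := by
  classical
  have h1 := Finset.sum_card_bipartiteAbove_eq_sum_card_bipartiteBelow
    (s := Finset.powersetCard (i + 1) (Finset.univ : Finset V)) (t := (Finset.univ : Finset V))
    (fun U v => v ∈ dominating G U)
  have h2 : ∀ U, Finset.bipartiteAbove (fun U v => v ∈ dominating G U) Finset.univ U =
      dominating G U := fun U => by
    ext
    simp [Finset.bipartiteAbove]
  simp only [h2] at h1
  rw [h1]
  refine Finset.sum_congr rfl fun v _ => ?_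
  rw [← G.card_neighborFinset_eq_degree, ← Finset.card_powersetCard]
  refine Finset.card_nbij' (fun U => U.erase v) (fun S => insert v S) ?_ ?_ ?_ ?_
  · intro U hU
    simp only [Finset.bipartiteBelow, Finset.coe_filter, Finset.mem_powersetCard,
      Set.mem_ofPred_eq, mem_dominating] at hU
    simp only [Finset.mem_coe, Finset.mem_powersetCard]
    refine ⟨fun w hw => ?_, by rw [Finset.card_erase_of_mem hU.2.1, hU.1.2]; rfl⟩
    rw [SimpleGraph.mem_neighborFinset]
    exact hU.2.2 w (Finset.mem_of_mem_erase hw) (Finset.ne_of_mem_erase hw)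
  · intro S hS
    simp only [Finset.mem_coe, Finset.mem_powersetCard] at hS
    have hv : v ∉ S := fun hv => by simpa using hS.1 hv
    simp only [Finset.bipartiteBelow, Finset.coe_filter, Finset.mem_powersetCard,
      Set.mem_ofPred_eq, mem_dominating]
    refine ⟨⟨Finset.subset_univ _, by rw [Finset.card_insert_of_notMem hv, hS.2]⟩, by simp,
      fun w hw hwv => ?_⟩
    simpa using hS.1 (Finset.mem_of_mem_insert_of_ne hw hwv)
  · intro U hU
    simp only [Finset.bipartiteBelow, Finset.coe_filter, Finset.mem_powersetCard,
      Set.mem_ofPred_eq, mem_dominating] at hU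
    exact Finset.insert_erase hU.2.1
  · intro S hS
    simp only [Finset.mem_coe, Finset.mem_powersetCard] at hS
    exact Finset.erase_insert fun hv => by simpa using hS.1 hv

lemma completeCount_eq_card_filter (m : ℕ) (G : SimpleGraph V)
    [DecidablePred fun U : Finset V => G.IsClique (U : Set V)] :
    completeCount m G =
      (({U ∈ Finset.powersetCard m Finset.univ | G.IsClique U} : Finset (Finset V))).card := by
  rw [completeCount_eq_ncard, ← Set.ncard_coe_finset]
  congr 1
  ext S
  simp [Finset.mem_powersetCard]

/-- Adding the cliques completes the non-cliques to all sets of `i + 1` vertices, and avoids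
subtraction in `ℕ`. -/
lemma finrank_nonedgeConstant_add (G : SimpleGraph V) [DecidableRel G.Adj] (i : ℕ)
    (h : ∀ U : Finset V, U.card = i + 1 → FourCycleFreeOn G U) :
    Module.finrank k (nonedgeConstant k G (i + 1)) + completeCount (i + 1) G =
      ∑ v : V, (G.degree v).choose i + (Fintype.card V).choose (i + 1) := by
  classical
  rw [finrank_nonedgeConstant G _ h, sum_card_dominating, completeCount_eq_card_filter, add_assoc,
    add_comm (Finset.card _), Finset.card_filter_add_card_filter_not, Finset.card_powersetCard,
    Finset.card_univ]

/-- One scalar for each set. It is the general count for the edgeless graph, where all degrees are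
zero and no set of at least two vertices is a clique. -/
lemma finrank_nonedgeConstant_bot (i : ℕ) :
    Module.finrank k (nonedgeConstant k (⊥ : SimpleGraph V) (i + 2)) =
      (Fintype.card V).choose (i + 2) := by
  classical
  have h := finrank_nonedgeConstant_add (k := k) (⊥ : SimpleGraph V) (i + 1)
    fun U _ a _ a' _ b _ b' _ _ _ _ _ h => by simp at h
  have h1 : completeCount (i + 2) (⊥ : SimpleGraph V) = 0 := by
    rw [completeCount_eq_card_filter, Finset.card_eq_zero, Finset.filter_eq_empty_iff]
    intro U hU hc
    have hU' := (Finset.mem_powersetCard.1 hU).2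
    obtain ⟨a, ha, b, hb, hab⟩ := Finset.one_lt_card.1 (show 1 < U.card by omega)
    exact hc ha hb hab
  rw [h1, add_zero] at h
  rw [h]
  simp

end Counting

/-! ### The Betti number formula -/

lemma edgeBetti_eq {k : Type*} [Field k] {V : Type*} [Fintype V] (G : SimpleGraph V)
    [DecidableRel G.Adj] (i : ℕ) (h : ∀ U : Finset V, U.card = i + 2 → FourCycleFreeOn G U) :
    (edgeBetti k G i (i + 2) : ℤ) =
      (∑ v : V, ((G.degree v).choose (i + 1) : ℤ)) - (completeCount (i + 2) G : ℤ) := by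
  -- Any order will do: it only fixes the Koszul signs, and the Betti number does not involve it.
  let _ : LinearOrder V := LinearOrder.lift' (Fintype.equivFin V) (Fintype.equivFin V).injective
  have h1 : edgeBetti k G i (i + 2) = Module.finrank k (strandCycles k G i) :=
    finrank_gradedTor_edgeIdeal G _ i
  have h2 := finrank_strandCycles (k := k) G i
  have h3 := finrank_nonedgeConstant_add (k := k) G (i + 1) h
  rw [finrank_nonedgeConstant_bot] at h2
  rw [h1, eq_sub_iff_add_eq]
  have h4 : Module.finrank k (strandCycles k G i) + completeCount (i + 2) G =
      ∑ v : V, (G.degree v).choose (i + 1) := by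
    have h5 : i + 1 + 1 = i + 2 := rfl
    rw [h5] at h3
    omega
  exact_mod_cast h4

end EdgeIdealBetti

end

theorem proposition2p4 {k : Type*} [Field k] {V : Type*} [Fintype V]
    (G : SimpleGraph V) [DecidableRel G.Adj] :
    (EdgeIdealBetti.NoInducedFourCycle G → ∀ i : ℕ,
      (EdgeIdealBetti.edgeBetti k G i (i + 2) : ℤ) =
        (∑ v : V, ((G.degree v).choose (i + 1) : ℤ))
          - (EdgeIdealBetti.completeCount (i + 2) G : ℤ)) ∧
    (∀ i : ℕ, i = 0 ∨ i = 1 →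
      (EdgeIdealBetti.edgeBetti k G i (i + 2) : ℤ) =
        (∑ v : V, ((G.degree v).choose (i + 1) : ℤ))
          - (EdgeIdealBetti.completeCount (i + 2) G : ℤ)) :=
  ⟨fun hG i => EdgeIdealBetti.edgeBetti_eq G i fun U _ =>
      EdgeIdealBetti.FourCycleFreeOn.of_noInducedFourCycle hG U,
    -- Here `U` has `i + 2 ≤ 3` vertices, too few for a 4-cycle.
    fun i hi => EdgeIdealBetti.edgeBetti_eq G i fun U hU =>
      EdgeIdealBetti.FourCycleFreeOn.of_card_le_three (by omega)⟩
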